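/- There are absolute constants $c_1,c_2,c_3>0$ with the following property. Let $f\in\mathbb{R}[x,y,z]$ be an irreducible polynomial of (total) degree $D$, let $E\ge D$ be a real number, and let $Q$ be a finite set of points in $\mathbb{R}^3$. Then there are a polynomial $g\in\mathbb{R}[x,y,z]$ of degree at most $E$ that is coprime to $f$ (that is, $f$ and $g$ have no non-constant common factor), an integer $t$ with $$c_1 D E^2\le t\le c_2 D E^2,$$ and a partition of $Q$ into pairwise disjoint, possibly empty subsets $Q_0,Q_1,\dots,Q_t$ such that $Q_0\subseteq Z(g)=\{p\in\mathbb{R}^3: g(p)=0\}$, there are $t$ pairwise distinct connected components $C_1,\dots,C_t$ of $\mathbb{R}^3\setminus Z(g)$ with $Q_i\subseteq C_i$ for $i=1,\dots,t$, and $|Q_i|\le c_3\,|Q|/t$ for $i=1,\dots,t$. -/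

import Mathlib

/-- The real zero set of a trivariate real polynomial, as a subset of `ℝ³`. -/
def zeroSet (p : MvPolynomial (Fin 3) ℝ) : Set (Fin 3 → ℝ) :=
  {x | MvPolynomial.eval x p = 0}

/-- `C` is a connected component of the subspace `S` of `ℝ³`. -/
def IsComponentOf (C S : Set (Fin 3 → ℝ)) : Prop :=
  ∃ x ∈ S, C = connectedComponentIn S x

/-- The polynomial `g` partitions the finite set `Q` into `Q₀ ⊆ Z(g)` and the (possibly empty)
sets `P 0, …, P (t - 1)`, which lie in pairwise distinct connected components of `ℝ³ \ Z(g)`,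
each `P i` inside a single component. -/
structure PartitionedBy (g : MvPolynomial (Fin 3) ℝ) (Q Q₀ : Finset (Fin 3 → ℝ))
    {t : ℕ} (P : Fin t → Finset (Fin 3 → ℝ)) : Prop where
  cover : (Q : Set (Fin 3 → ℝ)) = (Q₀ : Set (Fin 3 → ℝ)) ∪ ⋃ i, (P i : Set (Fin 3 → ℝ))
  disjoint_zero : ∀ i, Disjoint Q₀ (P i)
  disjoint_parts : ∀ i j, i ≠ j → Disjoint (P i) (P j)
  zero_subset : (Q₀ : Set (Fin 3 → ℝ)) ⊆ zeroSet g
  distinct_components : ∃ C : Fin t → Set (Fin 3 → ℝ), Function.Injective C ∧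
    ∀ i, IsComponentOf (C i) (zeroSet g)ᶜ ∧ (P i : Set (Fin 3 → ℝ)) ⊆ C i

namespace PolynomialPartition

open MvPolynomial

section LeadingMonomials

variable {σ : Type*}

/-- Polynomials all of whose monomials have `w`-weight less than `N`. -/
noncomputable def weightLT (w : σ → ℕ) (N : ℕ) : Submodule ℝ (MvPolynomial σ ℝ) :=
  restrictSupport ℝ {e | Finsupp.weight w e < N}

theorem mem_weightLT {w : σ → ℕ} {N : ℕ} {p : MvPolynomial σ ℝ} :
    p ∈ weightLT w N ↔ ∀ e ∈ p.support, Finsupp.weight w e < N := by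
  rw [weightLT, mem_restrictSupport_iff]
  rfl

theorem monomial_mem_weightLT {w : σ → ℕ} {N : ℕ} {e : σ →₀ ℕ} (h : Finsupp.weight w e < N)
    (c : ℝ) : monomial e c ∈ weightLT w N :=
  (monomial_mem_restrictSupport ℝ).2 (Or.inl h)

theorem weightLT_mono {w : σ → ℕ} {M N : ℕ} (h : M ≤ N) : weightLT w M ≤ weightLT w N :=
  restrictSupport_mono ℝ fun _ he => lt_of_lt_of_le he h

theorem mul_mem_weightLT {w : σ → ℕ} {M N : ℕ} {p q : MvPolynomial σ ℝ}
    (hp : p ∈ weightLT w M) (hq : q ∈ weightLT w (N + 1)) : p * q ∈ weightLT w (M + N) := by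
  classical
  rw [mem_weightLT] at *
  intro e he
  obtain ⟨a, ha, b, hb, rfl⟩ := Finset.mem_add.1 (support_mul p q he)
  have h1 := hp a ha
  have h2 := hq b hb
  rw [map_add]
  omega

/-- `p` is the monomial `e` plus terms of smaller `w`-weight. -/
def HasLead (w : σ → ℕ) (e : σ →₀ ℕ) (p : MvPolynomial σ ℝ) : Prop :=
  p - monomial e 1 ∈ weightLT w (Finsupp.weight w e)

theorem hasLead_monomial (w : σ → ℕ) (e : σ →₀ ℕ) : HasLead w e (monomial e 1) := by
  simp [HasLead]

theorem HasLead.mul {w : σ → ℕ} {e e' : σ →₀ ℕ} {p q : MvPolynomial σ ℝ}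
    (hp : HasLead w e p) (hq : HasLead w e' q) : HasLead w (e + e') (p * q) := by
  have hq' : q ∈ weightLT w (Finsupp.weight w e' + 1) := by
    have := (weightLT w (Finsupp.weight w e' + 1)).add_mem (weightLT_mono (Nat.le_succ _) hq)
      (monomial_mem_weightLT (Nat.lt_succ_self _) 1)
    rwa [sub_add_cancel] at this
  have h1 := mul_mem_weightLT hp hq'
  have h2 := mul_mem_weightLT hq (monomial_mem_weightLT (Nat.lt_succ_self (Finsupp.weight w e)) 1)
  unfold HasLead
  rw [map_add]
  rw [add_comm (Finsupp.weight w e')] at h2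
  have h3 : (monomial (e + e') (1 : ℝ)) = monomial e' 1 * monomial e 1 := by
    rw [monomial_mul, one_mul, add_comm]
  rw [h3]
  convert (weightLT w _).add_mem h1 h2 using 1
  ring

theorem HasLead.pow {w : σ → ℕ} {e : σ →₀ ℕ} {p : MvPolynomial σ ℝ} (hp : HasLead w e p) (n : ℕ) :
    HasLead w (n • e) (p ^ n) := by
  induction n with
  | zero => simpa using hasLead_monomial w 0
  | succ n ih =>
    rw [succ_nsmul, pow_succ]
    exact ih.mul hp

theorem HasLead.prod {ι : Type*} (s : Finset ι) {w : σ → ℕ} {e : ι → σ →₀ ℕ}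
    {p : ι → MvPolynomial σ ℝ} (hp : ∀ i ∈ s, HasLead w (e i) (p i)) :
    HasLead w (∑ i ∈ s, e i) (∏ i ∈ s, p i) := by
  classical
  induction s using Finset.induction_on with
  | empty => simpa using hasLead_monomial w 0
  | insert a s ha ih =>
    rw [Finset.sum_insert ha, Finset.prod_insert ha]
    exact (hp a (Finset.mem_insert_self _ _)).mul
      (ih fun i hi => hp i (Finset.mem_insert_of_mem hi))

/-- A linear endomorphism that sends each monomial to itself plus terms of smaller weight is
bijective. -/
theorem bijective_of_hasLead {w : σ → ℕ} (T : MvPolynomial σ ℝ →ₗ[ℝ] MvPolynomial σ ℝ)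
    (hT : ∀ e, HasLead w e (T (monomial e 1))) : Function.Bijective T := by
  have key : ∀ N, ∀ p ∈ weightLT w (N + 1), T p - p ∈ weightLT w N := by
    intro N p hp
    have : T p - p = ∑ e ∈ p.support, coeff e p • (T (monomial e 1) - monomial e 1) := by
      conv_lhs => rw [p.as_sum]
      simp only [map_sum, smul_sub, Finset.sum_sub_distrib, ← map_smul, smul_eq_mul,
        mul_one]
    rw [this]
    refine Submodule.sum_mem _ fun e he => Submodule.smul_mem _ _ ?_
    exact weightLT_mono (Nat.lt_succ_iff.1 (mem_weightLT.1 hp e he)) (hT e)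
  have bound : ∀ p : MvPolynomial σ ℝ, ∃ N, p ∈ weightLT w N := fun p =>
    ⟨p.support.sup (Finsupp.weight w) + 1, mem_weightLT.2 fun e he =>
      Nat.lt_succ_of_le (Finset.le_sup (f := Finsupp.weight w) he)⟩
  have zero : ∀ p ∈ weightLT w 0, p = 0 := by
    intro p hp
    rw [← support_eq_empty, Finset.eq_empty_iff_forall_notMem]
    intro e he
    exact absurd (mem_weightLT.1 hp e he) (Nat.not_lt_zero _)
  constructor
  · rw [← LinearMap.ker_eq_bot, LinearMap.ker_eq_bot']
    intro p hTp
    obtain ⟨N, hN⟩ := bound p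
    suffices h : ∀ N, p ∈ weightLT w N → p = 0 from h N hN
    intro N
    induction N with
    | zero => exact zero p
    | succ N ih =>
      intro hp
      have := key N p hp
      rw [hTp, zero_sub, Submodule.neg_mem_iff] at this
      exact ih this
  · intro p
    obtain ⟨N, hN⟩ := bound p
    suffices h : ∀ N, ∀ p ∈ weightLT w N, p ∈ LinearMap.range T from h N p hN
    intro N
    induction N with
    | zero => intro p hp; rw [zero p hp]; exact Submodule.zero_mem _
    | succ N ih =>
      intro p hp
      have h := (LinearMap.range T).sub_mem (LinearMap.mem_range_self T p) (ih _ (key N p hp))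
      rwa [sub_sub_cancel] at h

variable [Fintype σ]

/-- The remainders of an exponent vector modulo `d`. -/
noncomputable def expMod (d : σ → ℕ) (e : σ →₀ ℕ) : σ →₀ ℕ :=
  Finsupp.equivFunOnFinite.symm fun i => e i % d i

@[simp]
theorem expMod_apply (d : σ → ℕ) (e : σ →₀ ℕ) (i : σ) : expMod d e i = e i % d i := rfl

/-- The monomial `e` with every full power `X i ^ d i` replaced by `p i`. -/
noncomputable def substLead (p : σ → MvPolynomial σ ℝ) (d : σ → ℕ) (e : σ →₀ ℕ) :
    MvPolynomial σ ℝ :=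
  (∏ i, p i ^ (e i / d i)) * monomial (expMod d e) 1

/-- Linear extension of `substLead`. -/
noncomputable def substLeadMap (p : σ → MvPolynomial σ ℝ) (d : σ → ℕ) :
    MvPolynomial σ ℝ →ₗ[ℝ] MvPolynomial σ ℝ :=
  (basisMonomials σ ℝ).constr ℝ (substLead p d)

theorem substLeadMap_monomial (p : σ → MvPolynomial σ ℝ) (d : σ → ℕ) (e : σ →₀ ℕ) :
    substLeadMap p d (monomial e 1) = substLead p d e := by
  have := (basisMonomials σ ℝ).constr_basis ℝ (substLead p d) e
  rwa [coe_basisMonomials] at this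

theorem hasLead_substLead {w d : σ → ℕ} {p : σ → MvPolynomial σ ℝ}
    (hp : ∀ i, HasLead w (Finsupp.single i (d i)) (p i)) (e : σ →₀ ℕ) :
    HasLead w e (substLead p d e) := by
  have h := (HasLead.prod Finset.univ fun i _ => (hp i).pow (e i / d i)).mul
    (hasLead_monomial w (expMod d e))
  have he : ∑ i, (e i / d i) • Finsupp.single i (d i) + expMod d e = e := by
    classical
    ext j
    simp [Finsupp.single_apply, Nat.div_add_mod']
  rwa [he] at h

theorem substLeadMap_bijective {w d : σ → ℕ} {p : σ → MvPolynomial σ ℝ}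
    (hp : ∀ i, HasLead w (Finsupp.single i (d i)) (p i)) :
    Function.Bijective (substLeadMap p d) :=
  bijective_of_hasLead (w := w) _ fun e => by
    rw [substLeadMap_monomial]
    exact hasLead_substLead hp e

theorem substLead_of_lt {p : σ → MvPolynomial σ ℝ} {d : σ → ℕ} {e : σ →₀ ℕ}
    (h : ∀ i, e i < d i) : substLead p d e = monomial e 1 := by
  have he : expMod d e = e := by
    ext i
    simp [Nat.mod_eq_of_lt (h i)]
  simp [substLead, he, Nat.div_eq_of_lt (h _)]

theorem mul_substLead {p : σ → MvPolynomial σ ℝ} {d : σ → ℕ} (e : σ →₀ ℕ) (i : σ)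
    (hd : 0 < d i) :
    p i * substLead p d e = substLead p d (e + Finsupp.single i (d i)) := by
  classical
  have h1 : expMod d (e + Finsupp.single i (d i)) = expMod d e := by
    ext j
    by_cases h : i = j
    · subst h; simp
    · simp [h]
  have h2 : ∏ j, p j ^ ((e + Finsupp.single i (d i)) j / d j)
      = p i * ∏ j, p j ^ (e j / d j) := by
    rw [← Finset.mul_prod_erase _ _ (Finset.mem_univ i),
      ← Finset.mul_prod_erase Finset.univ (fun j => p j ^ (e j / d j)) (Finset.mem_univ i)]
    rw [← mul_assoc, ← pow_succ']
    congr 1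
    · simp [Nat.add_div_right _ hd]
    · refine Finset.prod_congr rfl fun j hj => ?_
      have : i ≠ j := (Finset.ne_of_mem_erase hj).symm
      simp [this]
  rw [substLead, substLead, h1, h2, mul_assoc]

theorem exists_factor_substLead {p : σ → MvPolynomial σ ℝ} {d : σ → ℕ} {e : σ →₀ ℕ} {i : σ}
    (hd : 0 < d i) (h : d i ≤ e i) : ∃ q, substLead p d e = p i * q := by
  classical
  refine ⟨substLead p d (e - Finsupp.single i (d i)), ?_⟩
  rw [mul_substLead _ _ hd, tsub_add_cancel_of_le]
  intro j
  by_cases hj : i = j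
  · subst hj; simpa
  · simp [hj]

/-- Finitely many points are separated by the values of polynomials. -/
theorem exists_eval_indicator (S : Finset (σ → ℝ)) (x : σ → ℝ) :
    ∃ q : MvPolynomial σ ℝ, eval x q ≠ 0 ∧ ∀ y ∈ S, y ≠ x → eval y q = 0 := by
  classical
  have hne : ∀ y : σ → ℝ, ∃ q : MvPolynomial σ ℝ, y ≠ x → eval x q ≠ 0 ∧ eval y q = 0 := by
    intro y
    by_cases h : y = x
    · exact ⟨0, fun h' => absurd h h'⟩
    · obtain ⟨i, hi⟩ := Function.ne_iff.1 h
      exact ⟨X i - C (y i), fun _ => ⟨by simpa [sub_eq_zero] using Ne.symm hi, by simp⟩⟩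
  choose q hq using hne
  refine ⟨∏ y ∈ S.erase x, q y, ?_, ?_⟩
  · rw [map_prod]
    exact Finset.prod_ne_zero_iff.2 fun y hy => (hq y (Finset.ne_of_mem_erase hy)).1
  · intro y hy hyx
    rw [map_prod]
    exact Finset.prod_eq_zero (Finset.mem_erase.2 ⟨hyx, hy⟩) (hq y hyx).2

/-- A weak Bézout bound: polynomials with leading terms `X i ^ d i` have at most `∏ i, d i` common
zeros. -/
theorem card_commonZeros_le {w d : σ → ℕ} {p : σ → MvPolynomial σ ℝ} (hd : ∀ i, 0 < d i)
    (hp : ∀ i, HasLead w (Finsupp.single i (d i)) (p i)) (S : Finset (σ → ℝ))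
    (hS : ∀ x ∈ S, ∀ i, eval x (p i) = 0) : S.card ≤ ∏ i, d i := by
  classical
  obtain ⟨ev, hev⟩ : ∃ ev : MvPolynomial σ ℝ →ₗ[ℝ] (S → ℝ), ∀ q x, ev q x = eval x.1 q :=
    ⟨LinearMap.pi fun x => (MvPolynomial.aeval x.1 : MvPolynomial σ ℝ →ₐ[ℝ] ℝ).toLinearMap,
      fun q x => by simp⟩
  let box : (∀ i, Fin (d i)) → (σ →₀ ℕ) := fun a => Finsupp.equivFunOnFinite.symm fun i => (a i : ℕ)
  have hspan : Submodule.span ℝ (Set.range fun a => ev (monomial (box a) 1)) = ⊤ := by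
    have htop : LinearMap.range ev = ⊤ := by
      rw [eq_top_iff]
      intro f _
      rw [← Finset.univ_sum_single f]
      refine Submodule.sum_mem _ fun x _ => ?_
      obtain ⟨q, hq, hq'⟩ := exists_eval_indicator S x.1
      refine ⟨(f x / eval x.1 q) • q, ?_⟩
      ext y
      rw [map_smul, Pi.smul_apply, hev]
      by_cases h : y = x
      · subst h; simp [hq]
      · rw [Pi.single_eq_of_ne h, hq' _ y.2 (fun h' => h (Subtype.ext h')), smul_zero]
    rw [eq_top_iff, ← htop]
    rintro _ ⟨q, rfl⟩
    obtain ⟨r, rfl⟩ := (substLeadMap_bijective hp).2 q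
    rw [r.as_sum, map_sum, map_sum]
    refine Submodule.sum_mem _ fun e _ => ?_
    have : monomial e (coeff e r) = coeff e r • monomial e (1 : ℝ) := by
      rw [smul_monomial, smul_eq_mul, mul_one]
    rw [this, map_smul, map_smul, substLeadMap_monomial]
    refine Submodule.smul_mem _ _ ?_
    by_cases h : ∀ i, e i < d i
    · rw [substLead_of_lt h]
      have hbox : box (fun i => ⟨e i, h i⟩) = e := by
        ext i
        simp [box]
      have hmem := Set.mem_range_self (f := fun a => ev (monomial (box a) 1)) fun i => ⟨e i, h i⟩
      beta_reduce at hmem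
      rw [hbox] at hmem
      exact Submodule.subset_span hmem
    · push Not at h
      obtain ⟨i, hi⟩ := h
      obtain ⟨q, hq⟩ := exists_factor_substLead (p := p) (hd i) hi
      have : ev (substLead p d e) = 0 := by
        ext x
        rw [hev, hq, map_mul, hS _ x.2, zero_mul, Pi.zero_apply]
      rw [this]
      exact Submodule.zero_mem _
  have h := finrank_range_le_card (R := ℝ) (fun a => ev (monomial (box a) 1))
  rw [Set.finrank, hspan, finrank_top, Module.finrank_fintype_fun_eq_card] at h
  simpa using h

end LeadingMonomials

section ComponentCount

theorem hasDerivAt_eval_update {σ : Type*} [DecidableEq σ] (p : MvPolynomial σ ℝ) (x : σ → ℝ)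
    (i : σ) (t : ℝ) :
    HasDerivAt (fun s => eval (Function.update x i s) p)
      (eval (Function.update x i t) (pderiv i p)) t := by
  induction p using MvPolynomial.induction_on with
  | C a => simpa using hasDerivAt_const t a
  | add p q hp hq =>
    simp only [map_add]
    exact hp.add hq
  | mul_X p j hp =>
    have hX : HasDerivAt (fun s => eval (Function.update x i s) (X j : MvPolynomial σ ℝ))
        (eval (Function.update x i t) (pderiv i (X j : MvPolynomial σ ℝ))) t := by
      by_cases h : j = i
      · subst h
        simpa using hasDerivAt_id' t
      · simpa [h, pderiv_X_of_ne h] using hasDerivAt_const t (x j)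
    have := hp.mul hX
    simp only [map_mul, pderiv_mul, map_add]
    exact this

theorem eval_pderiv_eq_zero_of_isLocalMax {σ : Type*} [Finite σ] {p : MvPolynomial σ ℝ} {x : σ → ℝ}
    (h : IsLocalMax (fun y => eval y p) x) (i : σ) : eval x (pderiv i p) = 0 := by
  classical
  have hc : Continuous fun s => Function.update x i s :=
    continuous_const.update i continuous_id
  have h1 : IsLocalMax (fun s => eval (Function.update x i s) p) (x i) := by
    have ht : Filter.Tendsto (fun s => Function.update x i s) (nhds (x i)) (nhds x) := by
      simpa using hc.tendsto (x i)
    have := ht.eventually h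
    simpa [IsLocalMax, IsMaxFilter] using this
  simpa using h1.hasDerivAt_eq_zero (hasDerivAt_eval_update p x i (x i))

theorem abs_eval_le {σ : Type*} [Fintype σ] (g : MvPolynomial σ ℝ) {c : σ → ℕ}
    (hc : ∀ i, degreeOf i g ≤ c i) :
    ∃ M : ℝ, 0 ≤ M ∧ ∀ x : σ → ℝ, |eval x g| ≤ M * ∏ i, max 1 |x i| ^ c i := by
  refine ⟨∑ e ∈ g.support, |coeff e g|, Finset.sum_nonneg fun _ _ => abs_nonneg _, fun x => ?_⟩
  rw [eval_eq', Finset.sum_mul]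
  refine (Finset.abs_sum_le_sum_abs _ _).trans (Finset.sum_le_sum fun e he => ?_)
  rw [abs_mul, Finset.abs_prod]
  refine mul_le_mul_of_nonneg_left (Finset.prod_le_prod (fun _ _ => abs_nonneg _) fun i _ => ?_)
    (abs_nonneg _)
  rw [abs_pow]
  calc |x i| ^ e i ≤ max 1 |x i| ^ e i := by gcongr; exact le_max_right _ _
    _ ≤ max 1 |x i| ^ c i :=
      pow_le_pow_right₀ (le_max_left _ _) ((monomial_le_degreeOf i he).trans (hc i))

theorem mul_mul_le_sum_cubes {a b c : ℝ} (ha : 0 ≤ a) (hb : 0 ≤ b) (hc : 0 ≤ c) :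
    a * b * c ≤ a ^ 3 + b ^ 3 + c ^ 3 := by
  nlinarith [mul_nonneg (add_nonneg (add_nonneg ha hb) hc) (sq_nonneg (a - b)),
    mul_nonneg (add_nonneg (add_nonneg ha hb) hc) (sq_nonneg (b - c)),
    mul_nonneg (add_nonneg (add_nonneg ha hb) hc) (sq_nonneg (a - c)),
    pow_nonneg ha 3, pow_nonneg hb 3, pow_nonneg hc 3, mul_nonneg (mul_nonneg ha hb) hc]

/-- The square of `g`, perturbed so as to tend to `-∞` at infinity. -/
noncomputable def perturbedSquare (g : MvPolynomial (Fin 3) ℝ) (c : Fin 3 → ℕ) (ε : ℝ) :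
    MvPolynomial (Fin 3) ℝ :=
  g ^ 2 - C ε * ∑ i, X i ^ (6 * c i + 2)

theorem eval_perturbedSquare (g : MvPolynomial (Fin 3) ℝ) (c : Fin 3 → ℕ) (ε : ℝ)
    (x : Fin 3 → ℝ) :
    eval x (perturbedSquare g c ε) = eval x g ^ 2 - ε * ∑ i, x i ^ (6 * c i + 2) := by
  simp [perturbedSquare]

theorem perturbedSquare_le_sum {g : MvPolynomial (Fin 3) ℝ} {c : Fin 3 → ℕ}
    (hc : ∀ i, degreeOf i g ≤ c i) {ε : ℝ} (hε : 0 < ε) :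
    ∃ M : ℝ, 0 ≤ M ∧ ∀ x : Fin 3 → ℝ, eval x (perturbedSquare g c ε) ≤
      ∑ i, (max 1 |x i| ^ (6 * c i) * (M - ε * max 1 |x i| ^ 2) + ε) := by
  obtain ⟨M, hM, h⟩ := abs_eval_le g hc
  refine ⟨M ^ 2, sq_nonneg _, fun x => ?_⟩
  rw [eval_perturbedSquare]
  have h1 : eval x g ^ 2 ≤ M ^ 2 * ∑ i, max 1 |x i| ^ (6 * c i) := by
    have h2 : eval x g ^ 2 ≤ (M * ∏ i, max 1 |x i| ^ c i) ^ 2 := by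
      rw [← sq_abs]
      exact pow_le_pow_left₀ (abs_nonneg _) (h x) 2
    refine h2.trans ?_
    rw [mul_pow]
    refine mul_le_mul_of_nonneg_left ?_ (sq_nonneg _)
    have hpos : ∀ i, 0 ≤ max 1 |x i| ^ (2 * c i) := fun i => by positivity
    have := mul_mul_le_sum_cubes (hpos 0) (hpos 1) (hpos 2)
    simp only [Fin.prod_univ_three, Fin.sum_univ_three, mul_pow, ← pow_mul] at this ⊢
    have e3 : ∀ n : ℕ, 2 * n * 3 = 6 * n := fun n => by ring
    have e2 : ∀ n : ℕ, n * 2 = 2 * n := fun n => by ring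
    simpa only [e3, e2] using this
  have h2 : ∀ i, max 1 |x i| ^ (6 * c i + 2) ≤ x i ^ (6 * c i + 2) + 1 := by
    intro i
    have he : Even (6 * c i + 2) := ⟨3 * c i + 1, by ring⟩
    rcases le_total |x i| 1 with h | h
    · rw [max_eq_left h, one_pow]
      linarith [he.pow_nonneg (x i)]
    · rw [max_eq_right h, he.pow_abs]
      linarith
  have h3 : ε * ∑ i, max 1 |x i| ^ (6 * c i + 2) ≤ ε * ∑ i, (x i ^ (6 * c i + 2) + 1) :=
    mul_le_mul_of_nonneg_left (Finset.sum_le_sum fun i _ => h2 i) hε.le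
  simp only [Fin.sum_univ_three, pow_add] at h1 h3 ⊢
  nlinarith

theorem bounded_of_perturbedSquare_nonneg {g : MvPolynomial (Fin 3) ℝ} {c : Fin 3 → ℕ}
    (hc : ∀ i, degreeOf i g ≤ c i) {ε : ℝ} (hε : 0 < ε) :
    ∃ R : ℝ, ∀ x, 0 ≤ eval x (perturbedSquare g c ε) → ∀ i, |x i| ≤ R := by
  obtain ⟨M, hM, h⟩ := perturbedSquare_le_sum hc hε
  have hψ : ∀ i, ∃ K : ℝ, 0 ≤ K ∧
      ∀ s : ℝ, 1 ≤ s → s ^ (6 * c i) * (M - ε * s ^ 2) + ε ≤ K := by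
    intro i
    refine ⟨max 1 (M / ε) ^ (6 * c i) * M + ε, by positivity, fun s hs => ?_⟩
    refine add_le_add_left ?_ ε
    rcases le_total s (max 1 (M / ε)) with h1 | h1
    · have h2 : s ^ (6 * c i) ≤ max 1 (M / ε) ^ (6 * c i) := by gcongr
      have h3 : 0 ≤ s ^ (6 * c i) := by positivity
      have h4 : 0 ≤ ε * s ^ 2 := by positivity
      nlinarith
    · have h2 : M / ε ≤ s := (le_max_right _ _).trans h1
      have h3 : M ≤ s * ε := (div_le_iff₀ hε).1 h2
      have h4 : M - ε * s ^ 2 ≤ 0 := by nlinarith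
      have h5 : 0 ≤ s ^ (6 * c i) := by positivity
      have h6 : (0 : ℝ) ≤ max 1 (M / ε) ^ (6 * c i) * M := by positivity
      nlinarith
  choose K hK0 hK using hψ
  refine ⟨max 1 ((M + ε + ∑ i, K i) / ε + 1), fun x hx i => ?_⟩
  by_contra! hlt
  set s := max 1 |x i| with hs
  have hxs : s = |x i| := max_eq_right ((le_max_left _ _).trans hlt.le)
  have hs1 : 1 ≤ s := le_max_left _ _
  have hsR : (M + ε + ∑ i, K i) / ε + 1 < s := by rw [hxs]; exact (le_max_right _ _).trans_lt hlt
  have hsR' : M + ε + ∑ i, K i < s * ε := by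
    rw [← div_lt_iff₀ hε]; linarith
  have hle := h x
  rw [← Finset.add_sum_erase _ _ (Finset.mem_univ i)] at hle
  have hrest : ∑ j ∈ Finset.univ.erase i,
      (max 1 |x j| ^ (6 * c j) * (M - ε * max 1 |x j| ^ 2) + ε) ≤ ∑ j, K j :=
    (Finset.sum_le_sum fun j _ => hK j _ (le_max_left _ _)).trans
      (Finset.sum_le_sum_of_subset_of_nonneg (Finset.erase_subset _ _) fun j _ _ => hK0 j)
  have hKs : 0 ≤ ∑ i, K i := Finset.sum_nonneg fun j _ => hK0 j
  rw [← hs] at hle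
  have hpow : 1 ≤ s ^ (6 * c i) := one_le_pow₀ hs1
  have hstrict : M - ε * s ^ 2 < -(ε + ∑ i, K i) := by nlinarith
  have : s ^ (6 * c i) * (M - ε * s ^ 2) < -(ε + ∑ i, K i) := by nlinarith
  linarith

theorem pderiv_perturbedSquare (g : MvPolynomial (Fin 3) ℝ) (c : Fin 3 → ℕ) (ε : ℝ) (i : Fin 3) :
    pderiv i (perturbedSquare g c ε) =
      pderiv i (g ^ 2) - C (ε * (6 * c i + 2 : ℕ)) * X i ^ (6 * c i + 1) := by
  have h : pderiv i (∑ j, (X j : MvPolynomial (Fin 3) ℝ) ^ (6 * c j + 2)) =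
      C ((6 * c i + 2 : ℕ) : ℝ) * X i ^ (6 * c i + 1) := by
    rw [map_sum, Finset.sum_eq_single i]
    · rw [pderiv_pow, pderiv_X_self, mul_one, map_natCast]
      rfl
    · intro j _ hj
      rw [pderiv_pow, pderiv_X_of_ne hj, mul_zero]
    · simp
  rw [perturbedSquare, map_sub, pderiv_C_mul, h, C_mul, mul_assoc]

theorem pderiv_sq_mem_weightLT {g : MvPolynomial (Fin 3) ℝ} {c : Fin 3 → ℕ}
    (hc : ∀ i, degreeOf i g ≤ c i) (i : Fin 3) :
    pderiv i (g ^ 2) ∈ weightLT (fun j => ∏ k ∈ Finset.univ.erase j, (6 * c k + 1))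
      (∏ k, (6 * c k + 1)) := by
  rw [mem_weightLT]
  intro e he
  have he' : e + Finsupp.single i 1 ∈ (g ^ 2).support := by
    rw [mem_support_iff, coeff_pderiv] at he
    rw [mem_support_iff]
    exact left_ne_zero_of_mul he
  have hle : ∀ j, e j ≤ 2 * c j := fun j =>
    calc e j ≤ (e + Finsupp.single i 1 : Fin 3 →₀ ℕ) j := by simp
      _ ≤ degreeOf j (g ^ 2) := monomial_le_degreeOf j he'
      _ ≤ 2 * degreeOf j g := degreeOf_pow_le j g 2
      _ ≤ 2 * c j := Nat.mul_le_mul_left 2 (hc j)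
  set w : Fin 3 → ℕ := fun j => ∏ k ∈ Finset.univ.erase j, (6 * c k + 1) with hw
  have hW : ∀ j, (6 * c j + 1) * w j = ∏ k, (6 * c k + 1) := fun j =>
    Finset.mul_prod_erase _ (fun k => 6 * c k + 1) (Finset.mem_univ j)
  have hpos : ∀ j, 0 < w j := fun j => Finset.prod_pos fun k _ => Nat.succ_pos _
  have hj : ∀ j, 3 * (e j * w j) < ∏ k, (6 * c k + 1) := by
    intro j
    rw [← hW j]
    nlinarith [hle j, hpos j, Nat.mul_le_mul_right (w j) (hle j)]
  rw [Finsupp.weight_apply, Finsupp.sum_fintype _ _ (by simp)]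
  simp only [smul_eq_mul, Fin.sum_univ_three]
  linarith [hj 0, hj 1, hj 2]

theorem card_critical_perturbedSquare_le {g : MvPolynomial (Fin 3) ℝ} {c : Fin 3 → ℕ}
    (hc : ∀ i, degreeOf i g ≤ c i) {ε : ℝ} (hε : 0 < ε) (S : Finset (Fin 3 → ℝ))
    (hS : ∀ x ∈ S, ∀ i, eval x (pderiv i (perturbedSquare g c ε)) = 0) :
    S.card ≤ ∏ i, (6 * c i + 1) := by
  have hk : ∀ i, ε * (6 * c i + 2 : ℕ) ≠ 0 := fun i => by positivity
  refine card_commonZeros_le (w := fun j => ∏ k ∈ Finset.univ.erase j, (6 * c k + 1))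
    (p := fun i => X i ^ (6 * c i + 1) - C (ε * (6 * c i + 2 : ℕ))⁻¹ * pderiv i (g ^ 2))
    (fun i => Nat.succ_pos _) (fun i => ?_) S fun x hx i => ?_
  · have hW : Finsupp.weight (fun j => ∏ k ∈ Finset.univ.erase j, (6 * c k + 1))
        (Finsupp.single i (6 * c i + 1)) = ∏ k, (6 * c k + 1) := by
      rw [Finsupp.weight_apply, Finsupp.sum_single_index (by simp), smul_eq_mul]
      exact Finset.mul_prod_erase _ (fun k => 6 * c k + 1) (Finset.mem_univ i)
    rw [HasLead, hW, X_pow_eq_monomial, sub_sub_cancel_left, Submodule.neg_mem_iff,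
      ← smul_eq_C_mul]
    exact Submodule.smul_mem _ _ (pderiv_sq_mem_weightLT hc i)
  · have h := hS x hx i
    rw [pderiv_perturbedSquare] at h
    simp only [map_sub, map_mul, eval_C, map_pow, eval_X] at h ⊢
    have := hk i
    rw [sub_eq_zero] at h ⊢
    rw [eq_inv_mul_iff_mul_eq₀ this, h]

theorem isOpen_compl_zeroSet (g : MvPolynomial (Fin 3) ℝ) : IsOpen (zeroSet g)ᶜ :=
  (isClosed_eq g.continuous_eval continuous_const).isOpen_compl

theorem mem_of_mem_closure_component {X : Type*} [TopologicalSpace X] {S : Set X} {x y : X}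
    (hx : x ∈ S) (hy : y ∈ closure (connectedComponentIn S x)) (hyS : y ∈ S) :
    y ∈ connectedComponentIn S x := by
  have hpre : IsPreconnected (insert y (connectedComponentIn S x)) :=
    isPreconnected_connectedComponentIn.subset_closure (Set.subset_insert _ _)
      (Set.insert_subset hy subset_closure)
  exact hpre.subset_connectedComponentIn
    (Set.mem_insert_of_mem _ (mem_connectedComponentIn hx))
    (Set.insert_subset hyS (connectedComponentIn_subset _ _)) (Set.mem_insert _ _)

theorem exists_critical_mem_component {g : MvPolynomial (Fin 3) ℝ} {c : Fin 3 → ℕ}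
    (hc : ∀ i, degreeOf i g ≤ c i) {ε : ℝ} (hε : 0 < ε) {q : Fin 3 → ℝ}
    (hq : 0 < eval q (perturbedSquare g c ε)) (hqg : q ∈ (zeroSet g)ᶜ) :
    ∃ x ∈ connectedComponentIn (zeroSet g)ᶜ q,
      ∀ i, eval x (pderiv i (perturbedSquare g c ε)) = 0 := by
  obtain ⟨R, hR⟩ := bounded_of_perturbedSquare_nonneg hc hε
  set F := perturbedSquare g c ε
  set K := closure (connectedComponentIn (zeroSet g)ᶜ q) ∩ Set.univ.pi fun _ => Set.Icc (-R) R
  have hK : IsCompact K :=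
    (isCompact_univ_pi fun _ => isCompact_Icc).inter_left isClosed_closure
  have hmemK : ∀ y ∈ closure (connectedComponentIn (zeroSet g)ᶜ q), 0 ≤ eval y F → y ∈ K :=
    fun y hy h0 => ⟨hy, fun i _ => abs_le.1 (hR y h0 i)⟩
  have hqC : q ∈ closure (connectedComponentIn (zeroSet g)ᶜ q) :=
    subset_closure (mem_connectedComponentIn hqg)
  obtain ⟨x, hxK, hx⟩ := hK.exists_isMaxOn ⟨q, hmemK q hqC hq.le⟩ F.continuous_eval.continuousOn
  have hFx : 0 < eval x F := hq.trans_le (hx (hmemK q hqC hq.le))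
  have hxg : x ∈ (zeroSet g)ᶜ := by
    intro h0
    rw [eval_perturbedSquare, show eval x g = 0 from h0] at hFx
    have : 0 ≤ ∑ i, x i ^ (6 * c i + 2) :=
      Finset.sum_nonneg fun i _ => Even.pow_nonneg ⟨3 * c i + 1, by ring⟩ _
    nlinarith
  have hxC := mem_of_mem_closure_component hqg hxK.1 hxg
  refine ⟨x, hxC, eval_pderiv_eq_zero_of_isLocalMax ?_⟩
  filter_upwards [(isOpen_compl_zeroSet g).connectedComponentIn.mem_nhds hxC] with y hy
  rcases le_total 0 (eval y F) with h | h
  · exact hx (hmemK y (subset_closure hy) h)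
  · exact h.trans hFx.le

/-- The complement of the zero set of a polynomial has at most `∏ i, (6 * c i + 1)` connected
components, where `c i` bounds the degree in the `i`-th variable. -/
theorem card_components_le {g : MvPolynomial (Fin 3) ℝ} {c : Fin 3 → ℕ}
    (hc : ∀ i, degreeOf i g ≤ c i) (𝒞 : Finset (Set (Fin 3 → ℝ)))
    (h𝒞 : ∀ C ∈ 𝒞, IsComponentOf C (zeroSet g)ᶜ) : 𝒞.card ≤ ∏ i, (6 * c i + 1) := by
  classical
  have hex : ∀ C : 𝒞, ∃ q ∈ (zeroSet g)ᶜ, C.1 = connectedComponentIn (zeroSet g)ᶜ q :=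
    fun C => h𝒞 C.1 C.2
  choose q hq hC using hex
  have hsmall : ∀ᶠ ε in nhdsWithin (0 : ℝ) (Set.Ioi 0), ∀ C : 𝒞,
      0 < eval (q C) (perturbedSquare g c ε) := by
    rw [Filter.eventually_all]
    intro C
    have hcont : Continuous fun ε : ℝ => eval (q C) (perturbedSquare g c ε) := by
      simp only [eval_perturbedSquare]
      fun_prop
    have h0 : 0 < eval (q C) (perturbedSquare g c 0) := by
      rw [eval_perturbedSquare]
      have : eval (q C) g ≠ 0 := hq C
      simpa using pow_pos (abs_pos.2 this) 2
    exact (hcont.continuousAt.eventually (lt_mem_nhds h0)).filter_mono nhdsWithin_le_nhds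
  obtain ⟨ε, hε, hε0⟩ := (hsmall.and self_mem_nhdsWithin).exists
  have hε0 : 0 < ε := hε0
  choose x hxC hx using fun C : 𝒞 => exists_critical_mem_component hc hε0 (hε C) (hq C)
  have hinj : Function.Injective x := by
    intro C C' h
    have h1 := connectedComponentIn_eq (hxC C)
    have h2 := connectedComponentIn_eq (hxC C')
    apply Subtype.ext
    rw [hC C, hC C', h1, h2, h]
  have := card_critical_perturbedSquare_le hc hε0 (Finset.univ.image x) (by
    intro y hy
    obtain ⟨C, -, rfl⟩ := Finset.mem_image.1 hy
    exact hx C)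
  rwa [Finset.card_image_of_injective _ hinj, Finset.card_univ, Fintype.card_coe] at this

end ComponentCount

section CommonEigenvector

theorem exists_isRoot_of_monic_of_odd {p : Polynomial ℝ} (hp : p.Monic) (hodd : Odd p.natDegree) :
    ∃ x, p.IsRoot x := by
  have hdeg : 0 < p.degree := Polynomial.natDegree_pos_iff_degree_pos.1 hodd.pos
  have htop := Polynomial.tendsto_atTop_of_leadingCoeff_nonneg p hdeg (by simp [hp.leadingCoeff])
  have hq : (-(p.comp (-Polynomial.X))).leadingCoeff = 1 := by
    rw [Polynomial.leadingCoeff_neg, Polynomial.leadingCoeff_comp (by simp), hp.leadingCoeff]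
    simp [hodd.neg_one_pow]
  have hqdeg : 0 < (-(p.comp (-Polynomial.X))).degree := by
    rw [Polynomial.degree_neg, ← Polynomial.natDegree_pos_iff_degree_pos, Polynomial.natDegree_comp]
    simpa using hodd.pos
  have hbot := Polynomial.tendsto_atTop_of_leadingCoeff_nonneg _ hqdeg (by rw [hq]; exact zero_le_one)
  obtain ⟨a, ha⟩ := (htop.eventually_ge_atTop 0).exists
  obtain ⟨b, hb⟩ := (hbot.eventually_ge_atTop 0).exists
  have hb' : p.eval (-b) ≤ 0 := by simpa using hb
  exact mem_range_of_exists_le_of_exists_ge p.continuous ⟨-b, hb'⟩ ⟨a, ha⟩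

universe u in
/-- Commuting endomorphisms of a real vector space of odd dimension have a common eigenvector. -/
theorem exists_common_eigenvector {ι : Type*} (n : ℕ) (hn : Odd n) :
    ∀ (V : Type u) [AddCommGroup V] [Module ℝ V] [FiniteDimensional ℝ V],
      Module.finrank ℝ V = n → ∀ f : ι → Module.End ℝ V, (∀ i j, Commute (f i) (f j)) →
        ∃ v : V, v ≠ 0 ∧ ∀ i, ∃ μ : ℝ, f i v = μ • v := by
  induction n using Nat.strong_induction_on with
  | _ n ih =>
  intro V _ _ _ hV f hf
  by_cases hscalar : ∀ i, ∃ μ : ℝ, ∀ v, f i v = μ • v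
  · have : Nontrivial V := Module.nontrivial_of_finrank_pos (R := ℝ) (hV ▸ hn.pos)
    obtain ⟨v, hv⟩ := exists_ne (0 : V)
    exact ⟨v, hv, fun i => (hscalar i).imp fun μ h => h v⟩
  push Not at hscalar
  obtain ⟨i, hi⟩ := hscalar
  obtain ⟨μ, hμ⟩ := exists_isRoot_of_monic_of_odd (f i).charpoly_monic
    (by rw [LinearMap.charpoly_natDegree, hV]; exact hn)
  rw [← Module.End.hasEigenvalue_iff_isRoot_charpoly] at hμ
  obtain ⟨v₀, hv₀⟩ := hμ.exists_hasEigenvector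
  set g : Module.End ℝ V := f i - algebraMap ℝ _ μ with hg
  have hg_apply : ∀ v, g v = f i v - μ • v := fun v => by simp [hg, Module.algebraMap_end_apply]
  have hcomm : ∀ j, Commute (f j) g := fun j =>
    (hf j i).sub_right (Algebra.commutes μ (f j)).symm
  have hcomm' : ∀ j v, f j (g v) = g (f j v) := fun j v => LinearMap.congr_fun (hcomm j) v
  -- an invariant proper subspace of odd dimension contains a common eigenvector
  have sub : ∀ W : Submodule ℝ V, Odd (Module.finrank ℝ W) → Module.finrank ℝ W < n →
      (∀ j, ∀ v ∈ W, f j v ∈ W) → ∃ v : V, v ≠ 0 ∧ ∀ i, ∃ μ : ℝ, f i v = μ • v := by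
    intro W hodd hlt hW
    obtain ⟨v, hv, h⟩ := ih _ hlt hodd W rfl (fun j => (f j).restrict (hW j)) fun j k => by
      refine LinearMap.ext fun v => Subtype.ext ?_
      exact LinearMap.congr_fun (hf j k) v.1
    refine ⟨v, fun h0 => hv (Subtype.ext h0), fun j => ?_⟩
    obtain ⟨ν, hν⟩ := h j
    exact ⟨ν, congrArg Subtype.val hν⟩
  have hsum := LinearMap.finrank_range_add_finrank_ker g
  have hker : 0 < Module.finrank ℝ (LinearMap.ker g) := by
    rw [Module.finrank_pos_iff_exists_ne_zero]
    exact ⟨⟨v₀, by simp [hg_apply, hv₀.apply_eq_smul]⟩, fun h => hv₀.2 (congrArg Subtype.val h)⟩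
  have hrange : 0 < Module.finrank ℝ (LinearMap.range g) := by
    obtain ⟨v, hv⟩ := hi μ
    rw [Module.finrank_pos_iff_exists_ne_zero]
    refine ⟨⟨g v, LinearMap.mem_range_self g v⟩, fun h => hv ?_⟩
    have : g v = 0 := congrArg Subtype.val h
    rwa [hg_apply, sub_eq_zero] at this
  rw [hV] at hsum
  rcases Nat.even_or_odd (Module.finrank ℝ (LinearMap.ker g)) with he | ho
  · refine sub (LinearMap.range g) ?_ (by omega) ?_
    · rw [← hsum] at hn
      exact (Nat.odd_add.1 hn).2 he
    · rintro j _ ⟨v, rfl⟩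
      exact ⟨f j v, (hcomm' j v).symm⟩
  · refine sub (LinearMap.ker g) ho (by omega) ?_
    intro j v hv
    rw [LinearMap.mem_ker] at hv ⊢
    rw [← hcomm', hv, map_zero]

end CommonEigenvector

section EvenFunctionals

variable {σ : Type*} [Fintype σ]

/-- The substitution `x ↦ -x`. -/
noncomputable def reflect (σ : Type*) : MvPolynomial σ ℝ →ₐ[ℝ] MvPolynomial σ ℝ :=
  aeval fun i => -X i

theorem eval_reflect {σ : Type*} (x : σ → ℝ) (q : MvPolynomial σ ℝ) :
    eval x (reflect σ q) = eval (-x) q := by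
  induction q using MvPolynomial.induction_on with
  | C a => simp [reflect]
  | add p q hp hq => simp [hp, hq]
  | mul_X p i hp => simp [hp]; simp [reflect]

theorem reflect_reflect {σ : Type*} (q : MvPolynomial σ ℝ) : reflect σ (reflect σ q) = q := by
  refine MvPolynomial.funext fun x => ?_
  rw [eval_reflect, eval_reflect, neg_neg]

theorem reflect_monomial (e : σ →₀ ℕ) :
    reflect σ (monomial e 1) = (-1 : ℝ) ^ (∑ i, e i) • monomial e 1 := by
  refine MvPolynomial.funext fun x => ?_
  rw [eval_reflect, smul_eval, eval_monomial, eval_monomial,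
    Finsupp.prod_fintype _ _ (by simp), Finsupp.prod_fintype _ _ (by simp), one_mul, one_mul,
    ← Finset.prod_pow_eq_pow_sum, ← Finset.prod_mul_distrib]
  refine Finset.prod_congr rfl fun i _ => ?_
  rw [Pi.neg_apply, neg_pow]

/-- Linear functionals on polynomials that vanish on the ideal generated by `p` and are invariant
under `x ↦ -x`. -/
noncomputable def evenFunctionals (p : σ → MvPolynomial σ ℝ) :
    Submodule ℝ (Module.Dual ℝ (MvPolynomial σ ℝ)) where
  carrier := {L | (∀ i q, L (p i * q) = 0) ∧ ∀ q, L (reflect σ q) = L q}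
  add_mem' := by
    rintro L L' ⟨h1, h2⟩ ⟨h1', h2'⟩
    exact ⟨fun i q => by simp [h1, h1'], fun q => by simp [h2, h2']⟩
  zero_mem' := ⟨fun i q => rfl, fun q => rfl⟩
  smul_mem' := by
    rintro a L ⟨h1, h2⟩
    exact ⟨fun i q => by simp [h1], fun q => by simp [h2]⟩

/-- Exponent vectors of even degree in the box `∏ i, [0, d i)`. -/
abbrev EvenBox (d : σ → ℕ) : Type _ :=
  {a : ∀ i, Fin (d i) // Even (∑ i, (a i : ℕ))}

/-- An element of the box as an exponent vector. -/
noncomputable def EvenBox.exp {d : σ → ℕ} (a : EvenBox d) : σ →₀ ℕ :=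
  Finsupp.equivFunOnFinite.symm fun i => (a.1 i : ℕ)

/-- Restriction of an even functional to the monomials in the box. -/
noncomputable def boxValues (p : σ → MvPolynomial σ ℝ) (d : σ → ℕ) :
    evenFunctionals p →ₗ[ℝ] (EvenBox d → ℝ) where
  toFun L a := L.1 (monomial a.exp 1)
  map_add' _ _ := rfl
  map_smul' _ _ := rfl

theorem boxValues_injective {w d : σ → ℕ} {p : σ → MvPolynomial σ ℝ} (hd : ∀ i, 0 < d i)
    (hp : ∀ i, HasLead w (Finsupp.single i (d i)) (p i)) :
    Function.Injective (boxValues p d) := by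
  rw [injective_iff_map_eq_zero]
  rintro ⟨L, hL, hL'⟩ h0
  have h0 : ∀ a : EvenBox d, L (monomial a.exp 1) = 0 := fun a => congrFun h0 a
  refine Subtype.ext ?_
  have hcomp : L ∘ₗ substLeadMap p d = 0 := by
    refine (basisMonomials σ ℝ).ext fun e => ?_
    rw [coe_basisMonomials, LinearMap.comp_apply, substLeadMap_monomial, LinearMap.zero_apply]
    by_cases h : ∀ i, e i < d i
    · rw [substLead_of_lt h]
      by_cases he : Even (∑ i, e i)
      · have := h0 ⟨fun i => ⟨e i, h i⟩, he⟩
        convert this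
        ext i
        rfl
      · have h1 := hL' (monomial e 1)
        rw [reflect_monomial, (Nat.not_even_iff_odd.1 he).neg_one_pow, map_smul, smul_eq_mul] at h1
        linarith
    · push Not at h
      obtain ⟨i, hi⟩ := h
      obtain ⟨q, hq⟩ := exists_factor_substLead (p := p) (hd i) hi
      rw [hq, hL]
  refine LinearMap.ext fun q => ?_
  obtain ⟨r, rfl⟩ := (substLeadMap_bijective hp).2 q
  exact LinearMap.congr_fun hcomp r

theorem reflect_substLead {d : σ → ℕ} {p : σ → MvPolynomial σ ℝ}
    (hpar : ∀ i, reflect σ (p i) = (-1 : ℝ) ^ d i • p i) (e : σ →₀ ℕ) :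
    reflect σ (substLead p d e) = (-1 : ℝ) ^ (∑ i, e i) • substLead p d e := by
  have h1 : ∑ i, e i = ∑ i, d i * (e i / d i) + ∑ i, expMod d e i := by
    rw [← Finset.sum_add_distrib]
    exact Finset.sum_congr rfl fun i _ => (Nat.div_add_mod _ _).symm
  rw [substLead, map_mul, map_prod, reflect_monomial, h1, pow_add]
  have h2 : ∀ i, reflect σ (p i ^ (e i / d i)) =
      (-1 : ℝ) ^ (d i * (e i / d i)) • p i ^ (e i / d i) := fun i => by
    rw [map_pow, hpar, smul_pow, ← pow_mul]
  simp only [h2]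
  rw [Finset.prod_smul, smul_mul_smul_comm, Finset.prod_pow_eq_pow_sum]

theorem boxValues_surjective {w d : σ → ℕ} {p : σ → MvPolynomial σ ℝ} (hd : ∀ i, 0 < d i)
    (hp : ∀ i, HasLead w (Finsupp.single i (d i)) (p i))
    (hpar : ∀ i, reflect σ (p i) = (-1 : ℝ) ^ d i • p i) :
    Function.Surjective (boxValues p d) := by
  classical
  intro c
  let T := LinearEquiv.ofBijective (substLeadMap p d) (substLeadMap_bijective hp)
  have hT : ∀ e, T (monomial e 1) = substLead p d e := substLeadMap_monomial p d
  obtain ⟨ℓ, hℓ⟩ : ∃ ℓ : Module.Dual ℝ (MvPolynomial σ ℝ), ∀ e, ℓ (monomial e 1) =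
      if h : (∀ i, e i < d i) ∧ Even (∑ i, e i) then c ⟨fun i => ⟨e i, h.1 i⟩, h.2⟩ else 0 := by
    refine ⟨(basisMonomials σ ℝ).constr ℝ fun e =>
      if h : (∀ i, e i < d i) ∧ Even (∑ i, e i) then c ⟨fun i => ⟨e i, h.1 i⟩, h.2⟩ else 0,
      fun e => ?_⟩
    conv_lhs => rw [← congrFun (coe_basisMonomials σ ℝ) e, Module.Basis.constr_basis]
  refine ⟨⟨ℓ ∘ₗ T.symm.toLinearMap, fun i q => ?_, fun q => ?_⟩, ?_⟩
  · obtain ⟨r, rfl⟩ := T.surjective q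
    suffices h : ℓ ∘ₗ T.symm.toLinearMap ∘ₗ LinearMap.mulLeft ℝ (p i) ∘ₗ T.toLinearMap = 0 from
      LinearMap.congr_fun h r
    refine (basisMonomials σ ℝ).ext fun e => ?_
    rw [coe_basisMonomials]
    simp only [LinearMap.comp_apply, LinearEquiv.coe_coe, LinearMap.mulLeft_apply,
      LinearMap.zero_apply]
    rw [hT, mul_substLead _ _ (hd i), ← hT, T.symm_apply_apply, hℓ, dif_neg]
    rintro ⟨h, -⟩
    have := h i
    simp at this
  · obtain ⟨r, rfl⟩ := T.surjective q
    suffices h : ℓ ∘ₗ T.symm.toLinearMap ∘ₗ (reflect σ).toLinearMap ∘ₗ T.toLinearMap = ℓ by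
      have := LinearMap.congr_fun h r
      simpa using this
    refine (basisMonomials σ ℝ).ext fun e => ?_
    rw [coe_basisMonomials]
    simp only [LinearMap.comp_apply, LinearEquiv.coe_coe, AlgHom.toLinearMap_apply]
    rw [hT, reflect_substLead hpar, ← hT, map_smul, map_smul, T.symm_apply_apply]
    by_cases he : Even (∑ i, e i)
    · rw [he.neg_one_pow, one_smul]
    · rw [hℓ, dif_neg fun h => he h.2, smul_zero]
  · ext a
    have ha : ∀ i, a.exp i < d i := fun i => (a.1 i).2
    change ℓ (T.symm (monomial a.exp 1)) = c a
    rw [← substLead_of_lt (p := p) ha, ← hT, T.symm_apply_apply, hℓ, dif_pos ⟨ha, a.2⟩]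
    rfl

end EvenFunctionals

section BorsukUlam

/-- If a system of polynomials with leading terms `X i ^ d i` respects the reflection `x ↦ -x`,
contains `∑ i, X i ^ 2 - 1`, and has an odd number of even box monomials, then its odd members
have a common real zero on the unit sphere. -/
theorem exists_zero_on_sphere_of_odd_card {σ : Type*} [Fintype σ] {w d : σ → ℕ}
    {p : σ → MvPolynomial σ ℝ} (hd : ∀ i, 0 < d i)
    (hp : ∀ i, HasLead w (Finsupp.single i (d i)) (p i))
    (hpar : ∀ i, reflect σ (p i) = (-1 : ℝ) ^ d i • p i)
    (hcard : Odd (Nat.card (EvenBox d))) {i₀ : σ} (hi₀ : p i₀ = ∑ i, X i ^ 2 - 1) :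
    ∃ v : σ → ℝ, ∑ i, v i ^ 2 = 1 ∧ ∀ i, Odd (d i) → eval v (p i) = 0 := by
  have := Fintype.ofFinite (EvenBox d)
  let e := LinearEquiv.ofBijective (boxValues p d)
    ⟨boxValues_injective hd hp, boxValues_surjective hd hp hpar⟩
  have hfin : FiniteDimensional ℝ (evenFunctionals p) := e.symm.finiteDimensional
  have hrank : Module.finrank ℝ (evenFunctionals p) = Nat.card (EvenBox d) := by
    rw [e.finrank_eq, Nat.card_eq_fintype_card, Module.finrank_fintype_fun_eq_card]
  have hXX : ∀ i j : σ, reflect σ (X i * X j) = X i * X j := fun i j => by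
    simp [reflect]
  let M : σ × σ → Module.End ℝ (evenFunctionals p) := fun ij =>
    (Module.Dual.transpose (R := ℝ)
      (LinearMap.mulLeft ℝ (X ij.1 * X ij.2 : MvPolynomial σ ℝ))).restrict
      (p := evenFunctionals p) (q := evenFunctionals p) (by
        rintro L ⟨h1, h2⟩
        refine ⟨fun i q => ?_, fun q => ?_⟩
        · rw [Module.Dual.transpose_apply, LinearMap.comp_apply, LinearMap.mulLeft_apply,
            mul_left_comm, h1]
        · rw [Module.Dual.transpose_apply, LinearMap.comp_apply, LinearMap.mulLeft_apply,
            LinearMap.comp_apply, LinearMap.mulLeft_apply, ← h2 (_ * q),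
            map_mul (reflect σ), hXX])
  have hM : ∀ ij (L : evenFunctionals p) q, (M ij L).1 q = L.1 (X ij.1 * X ij.2 * q) :=
    fun _ _ _ => rfl
  obtain ⟨L, hL0, hL⟩ := exists_common_eigenvector _ (hrank ▸ hcard) (evenFunctionals p) rfl M
    (fun a b => LinearMap.ext fun L => Subtype.ext (LinearMap.ext fun q => by
      simp only [Module.End.mul_apply, hM]
      congr 1
      ring))
  choose μ hμ using hL
  obtain ⟨L, hL1, hL2⟩ := L
  have hmul : ∀ i j q, L (X i * X j * q) = μ (i, j) * L q := fun i j q =>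
    LinearMap.congr_fun (congrArg Subtype.val (hμ (i, j))) q
  obtain ⟨q₀, hq₀⟩ : ∃ q, L q ≠ 0 := by
    by_contra! h
    exact hL0 (Subtype.ext (LinearMap.ext h))
  have hrel : ∀ i j k l, μ (i, j) * μ (k, l) = μ (i, k) * μ (j, l) := by
    intro i j k l
    refine mul_right_cancel₀ hq₀ ?_
    rw [mul_assoc, mul_assoc, ← hmul, ← hmul, ← hmul, ← hmul]
    congr 1
    ring
  have htrace : ∑ i, μ (i, i) = 1 := by
    refine mul_right_cancel₀ hq₀ ?_
    have h := hL1 i₀ q₀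
    rw [hi₀, sub_mul, map_sub, Finset.sum_mul, map_sum, one_mul, sub_eq_zero] at h
    rw [Finset.sum_mul, one_mul]
    refine Eq.trans (Finset.sum_congr rfl fun i _ => ?_) h
    rw [← hmul, sq]
  obtain ⟨a, ha⟩ : ∃ a, 0 < μ (a, a) := by
    by_contra! h
    have := Finset.sum_nonpos fun i (_ : i ∈ Finset.univ) => h i
    linarith
  set v : σ → ℝ := fun j => μ (a, j) / √(μ (a, a)) with hv
  have hvv : ∀ j k, v j * v k = μ (j, k) := by
    intro j k
    rw [hv, div_mul_div_comm, Real.mul_self_sqrt ha.le, div_eq_iff ha.ne', hrel a j a k, mul_comm]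
  have hsphere : ∑ i, v i ^ 2 = 1 := by
    rw [← htrace]
    exact Finset.sum_congr rfl fun i _ => by rw [sq, hvv]
  have hodd : ∀ j, L (X j) = 0 := fun j => by
    have h := hL2 (X j)
    rw [show reflect σ (X j : MvPolynomial σ ℝ) = -X j by simp [reflect], map_neg] at h
    linarith
  have hrep : ∀ q, L q = (eval v q + eval (-v) q) / 2 * L 1 ∧
      ∀ j, L (X j * q) = v j * (eval v q - eval (-v) q) / 2 * L 1 := by
    intro q
    induction q using MvPolynomial.induction_on with
    | C b =>
      refine ⟨?_, fun j => ?_⟩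
      · rw [show (C b : MvPolynomial σ ℝ) = b • 1 by rw [smul_eq_C_mul, mul_one], map_smul]
        simp
      · rw [mul_comm, ← smul_eq_C_mul, map_smul, hodd]
        simp
    | add p q hp hq =>
      refine ⟨?_, fun j => ?_⟩
      · rw [map_add, hp.1, hq.1, map_add, map_add]; ring
      · rw [mul_add, map_add, hp.2, hq.2, map_add, map_add]; ring
    | mul_X q k hq =>
      refine ⟨?_, fun j => ?_⟩
      · rw [mul_comm, hq.2]
        simp only [map_mul, eval_X, Pi.neg_apply]
        ring
      · rw [mul_comm q, ← mul_assoc, hmul, hq.1, ← hvv]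
        simp only [map_mul, eval_X, Pi.neg_apply]
        ring
  have hL1ne : L 1 ≠ 0 := fun h => hq₀ (by rw [(hrep q₀).1, h, mul_zero])
  refine ⟨v, hsphere, fun i hi => ?_⟩
  obtain ⟨j, hj⟩ : ∃ j, v j ≠ 0 := by
    by_contra! h
    simp [h] at hsphere
  have h1 := hL1 i (X j)
  have h2 : eval (-v) (p i) = -eval v (p i) := by
    rw [← eval_reflect, hpar, hi.neg_one_pow, smul_eval, neg_one_mul]
  rw [mul_comm, (hrep (p i)).2 j, h2] at h1
  have h3 : v j * L 1 * eval v (p i) = 0 := by linear_combination h1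
  exact (mul_eq_zero.1 h3).resolve_left (mul_ne_zero hj hL1ne)

theorem odd_card_evenBox {ι : Type*} [Fintype ι] {K : ℕ} (hK : Odd K) :
    Odd (Nat.card (EvenBox (fun o : Option ι => o.elim 2 fun _ => K))) := by
  have e : EvenBox (fun o : Option ι => o.elim 2 fun _ => K) ≃ (ι → Fin K) :=
    { toFun := fun a i => a.1 (some i)
      invFun := fun b => ⟨fun o => match o with
          | none => ⟨(∑ i, (b i : ℕ)) % 2, Nat.mod_lt _ two_pos⟩
          | some i => b i, by
        rw [Fintype.sum_option, Nat.even_iff]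
        simp only
        omega⟩
      left_inv := by
        rintro ⟨a, ha⟩
        refine Subtype.ext (funext fun o => ?_)
        cases o with
        | none =>
          rw [Fintype.sum_option, Nat.even_iff] at ha
          have h2 : (a none : ℕ) < 2 := (a none).2
          refine Fin.ext ?_
          simp only
          omega
        | some i => rfl
      right_inv := fun b => rfl }
  classical
  rw [Nat.card_congr e, Nat.card_eq_fintype_card, Fintype.card_fun, Fintype.card_fin]
  exact hK.pow

theorem exists_sphere_abs_eval_le {ι : Type*} [Fintype ι]
    (f : ι → MvPolynomial (Option ι) ℝ) (hf : ∀ i, reflect _ (f i) = -f i) {ε : ℝ} (hε : 0 < ε) :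
    ∃ v : Option ι → ℝ, ∑ o, v o ^ 2 = 1 ∧ ∀ i, |eval v (f i)| ≤ ε := by
  classical
  let N := Finset.univ.sup fun i => (f i).totalDegree
  have hN : ∀ i, (f i).totalDegree ≤ N := fun i =>
    Finset.le_sup (f := fun i => (f i).totalDegree) (Finset.mem_univ i)
  let K := 2 * N + 1
  have hK : Odd K := ⟨N, rfl⟩
  let d : Option ι → ℕ := fun o => o.elim 2 fun _ => K
  let w : Option ι → ℕ := fun o => o.elim 2 fun _ => 1
  let p : Option ι → MvPolynomial (Option ι) ℝ := fun o =>
    o.elim (∑ o, X o ^ 2 - 1) fun i => X (some i) ^ K + C ε⁻¹ * f i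
  have hw : ∀ e : Option ι →₀ ℕ, Finsupp.weight w e ≤ 2 * e.sum fun _ n => n := by
    intro e
    rw [Finsupp.weight_apply, Finsupp.sum, Finsupp.sum, Finset.mul_sum]
    refine Finset.sum_le_sum fun o _ => ?_
    rw [smul_eq_mul, mul_comm]
    refine Nat.mul_le_mul_right _ ?_
    cases o <;> simp [w]
  have hlead : ∀ o, HasLead w (Finsupp.single o (d o)) (p o) := by
    intro o
    cases o with
    | none =>
      have h : p none - monomial (Finsupp.single none (d none)) 1 =
          ∑ i : ι, X (some i) ^ 2 - monomial 0 1 := by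
        simp only [p, d, Option.elim_none, Fintype.sum_option, ← X_pow_eq_monomial]
        rw [monomial_zero', C_1]
        ring
      rw [HasLead, h]
      have hW : Finsupp.weight w (Finsupp.single none (d none)) = 4 := by
        rw [Finsupp.weight_apply, Finsupp.sum_single_index (by simp)]
        rfl
      rw [hW]
      refine Submodule.sub_mem _ (Submodule.sum_mem _ fun i _ => ?_) ?_
      · rw [X_pow_eq_monomial]
        refine monomial_mem_weightLT ?_ _
        rw [Finsupp.weight_apply, Finsupp.sum_single_index (by simp)]
        simp [w]
      · exact monomial_mem_weightLT (by simp) _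
    | some i =>
      have hW : Finsupp.weight w (Finsupp.single (some i) (d (some i))) = K := by
        rw [Finsupp.weight_apply, Finsupp.sum_single_index (by simp)]
        simp [w, d]
      have h : p (some i) - monomial (Finsupp.single (some i) (d (some i))) 1 = ε⁻¹ • f i := by
        simp only [p, d, Option.elim_some, ← X_pow_eq_monomial, smul_eq_C_mul]
        ring
      rw [HasLead, h, hW]
      refine Submodule.smul_mem _ _ (mem_weightLT.2 fun e he => ?_)
      have := (hw e).trans (Nat.mul_le_mul_left 2 ((le_totalDegree he).trans (hN i)))
      omega
  have hpar : ∀ o, reflect _ (p o) = (-1 : ℝ) ^ d o • p o := by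
    intro o
    cases o with
    | none => simp [p, d, reflect]
    | some i =>
      simp only [p, d, Option.elim_some, map_add, map_mul, hf, hK.neg_one_pow, map_pow]
      simp only [reflect, aeval_X, hK.neg_pow, algHom_C, algebraMap_eq]
      rw [neg_smul, one_smul]
      ring
  obtain ⟨v, hv, hv0⟩ := exists_zero_on_sphere_of_odd_card (d := d) (i₀ := none)
    (fun o => by cases o <;> simp [d, K]) hlead hpar (odd_card_evenBox hK) rfl
  refine ⟨v, hv, fun i => ?_⟩
  have h := hv0 (some i) hK
  have h1 : eval v (f i) = -(ε * v (some i) ^ K) := by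
    simp only [p, Option.elim_some, map_add, map_mul, map_pow, eval_X, eval_C] at h
    field_simp at h
    linarith
  have hle : |v (some i)| ≤ 1 := by
    rw [← sq_le_one_iff_abs_le_one, ← hv]
    exact Finset.single_le_sum (f := fun o => v o ^ 2) (fun o _ => sq_nonneg _) (Finset.mem_univ _)
  rw [h1, abs_neg, abs_mul, abs_pow, abs_of_pos hε]
  exact mul_le_of_le_one_right hε.le (pow_le_one₀ (abs_nonneg _) hle)

theorem isCompact_sphere {σ : Type*} [Fintype σ] : IsCompact {v : σ → ℝ | ∑ i, v i ^ 2 = 1} := by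
  refine (isCompact_univ_pi fun _ => isCompact_Icc (a := (-1 : ℝ)) (b := 1)).of_isClosed_subset
    (isClosed_eq (by fun_prop) continuous_const) fun v hv i _ => ?_
  have hv : ∑ i, v i ^ 2 = 1 := hv
  rw [Set.mem_Icc, ← abs_le, ← sq_le_one_iff_abs_le_one, ← hv]
  exact Finset.single_le_sum (f := fun o => v o ^ 2) (fun o _ => sq_nonneg _) (Finset.mem_univ _)

theorem exists_polynomial_near {σ : Type*} {S : Set (σ → ℝ)} (hS : IsCompact S)
    {h : (σ → ℝ) → ℝ} (hh : Continuous h) {ε : ℝ} (hε : 0 < ε) :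
    ∃ p : MvPolynomial σ ℝ, ∀ x ∈ S, |eval x p - h x| < ε := by
  let φ : MvPolynomial σ ℝ →ₐ[ℝ] C(σ → ℝ, ℝ) := aeval fun i => ⟨fun x => x i, continuous_apply i⟩
  have hφ : ∀ p x, φ p x = eval x p := by
    intro p x
    induction p using MvPolynomial.induction_on with
    | C a => simp [φ]
    | add p q hp hq => simp [hp, hq]
    | mul_X p i hp => simp [hp]; simp [φ]
  have hsep : φ.range.SeparatesPoints := by
    intro x y hxy
    obtain ⟨i, hi⟩ := Function.ne_iff.1 hxy
    exact ⟨_, ⟨φ (X i), ⟨X i, rfl⟩, rfl⟩, by simpa [hφ] using hi⟩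
  obtain ⟨_, ⟨p, rfl⟩, hp⟩ :=
    ContinuousMap.exists_mem_subalgebra_near_continuous_of_isCompact_of_separatesPoints hsep
      ⟨h, hh⟩ hS hε
  exact ⟨p, fun x hx => by simpa [hφ] using hp x hx⟩

/-- The Borsuk–Ulam theorem: an odd continuous map from the sphere of dimension `card ι` to
`ℝ^ι` has a zero. -/
theorem borsuk_ulam {ι : Type*} [Fintype ι] {h : (Option ι → ℝ) → ι → ℝ} (hc : Continuous h)
    (hodd : ∀ x, h (-x) = -h x) : ∃ v : Option ι → ℝ, ∑ o, v o ^ 2 = 1 ∧ h v = 0 := by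
  by_contra! hne
  let S := {v : Option ι → ℝ | ∑ o, v o ^ 2 = 1}
  obtain ⟨c, hc0, hcS⟩ : ∃ c > 0, ∀ v ∈ S, c ≤ ‖h v‖ := by
    rcases S.eq_empty_or_nonempty with hS | hS
    · exact ⟨1, one_pos, by simp [hS]⟩
    · obtain ⟨x, hx, hmin⟩ := isCompact_sphere.exists_isMinOn hS hc.norm.continuousOn
      exact ⟨‖h x‖, norm_pos_iff.2 (hne x hx), fun v hv => hmin hv⟩
  have hε : 0 < c / 3 := by positivity
  choose p hp using fun i =>
    exists_polynomial_near (isCompact_sphere (σ := Option ι)) ((continuous_apply i).comp hc) hε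
  obtain ⟨v, hv, hvf⟩ := exists_sphere_abs_eval_le
    (fun i => C (1 / 2) * (p i - reflect _ (p i))) (fun i => by
      rw [map_mul, map_sub, reflect_reflect, show reflect (Option ι) (C (1 / 2)) = C (1 / 2) by
        simp [reflect]]
      ring) hε
  have hlt : ‖h v‖ < c := by
    rw [pi_norm_lt_iff hc0]
    intro i
    have hv' : -v ∈ {v : Option ι → ℝ | ∑ o, v o ^ 2 = 1} := by
      simpa using hv
    have h1 := abs_lt.1 (hp i v hv)
    have h2 := abs_lt.1 (hp i (-v) hv')
    have h3 := abs_le.1 (hvf i)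
    simp only [map_mul, eval_C, map_sub, eval_reflect] at h3
    simp only [Function.comp_apply, hodd, Pi.neg_apply] at h1 h2
    rw [Real.norm_eq_abs, abs_lt]
    constructor <;> linarith [h1.1, h1.2, h2.1, h2.2, h3.1, h3.2]
  exact absurd (hcS v hv) (not_le.2 hlt)

end BorsukUlam

section HamSandwich

open Filter Topology in
/-- The discrete ham sandwich theorem for a linear space of functions: some nontrivial
combination of `card ι + 1` functions bisects `card ι` finite sets. -/
theorem ham_sandwich {ι X : Type*} [Fintype ι] (φ : Option ι → X → ℝ) (S : ι → Finset X) :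
    ∃ v : Option ι → ℝ, ∑ o, v o ^ 2 = 1 ∧ ∀ i,
      2 * ((S i).filter fun q => 0 < ∑ o, v o * φ o q).card ≤ (S i).card ∧
      2 * ((S i).filter fun q => ∑ o, v o * φ o q < 0).card ≤ (S i).card := by
  classical
  let a : X → (Option ι → ℝ) → ℝ := fun q v => ∑ o, v o * φ o q
  have ha : ∀ q, Continuous (a q) := fun q => by
    simp only [a]
    fun_prop
  let clamp : ℝ → ℝ := fun s => max (-1) (min 1 s)
  have hclamp : Continuous clamp := by fun_prop
  have hneg : ∀ s, clamp (-s) = -clamp s := by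
    intro s
    simp only [clamp, max_def, min_def]
    split_ifs <;> linarith
  have hle1 : ∀ s, clamp s ≤ 1 := fun s => max_le (by norm_num) (min_le_left _ _)
  have hge1 : ∀ s, -1 ≤ clamp s := fun s => le_max_left _ _
  have hone : ∀ s, 1 ≤ s → clamp s = 1 := fun s hs => by
    simp [clamp, hs]
  have hmone : ∀ s, s ≤ -1 → clamp s = -1 := fun s hs => by
    rw [← neg_neg s, hneg, hone _ (by linarith)]
  have hex : ∀ k : ℕ, ∃ v ∈ {v : Option ι → ℝ | ∑ o, v o ^ 2 = 1},
      ∀ i, ∑ q ∈ S i, clamp (k * a q v) = 0 := by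
    intro k
    obtain ⟨v, hv, h0⟩ := borsuk_ulam (ι := ι)
      (h := fun v i => ∑ q ∈ S i, clamp (k * a q v)) (by fun_prop) (fun x => by
        ext i
        simp only [Pi.neg_apply, ← Finset.sum_neg_distrib]
        refine Finset.sum_congr rfl fun q _ => ?_
        rw [← hneg, ← mul_neg]
        simp only [a, Pi.neg_apply, neg_mul, Finset.sum_neg_distrib])
    exact ⟨v, hv, fun i => congrFun h0 i⟩
  choose v hv h0 using hex
  obtain ⟨u, hu, ψ, hψ, hlim⟩ := isCompact_sphere.tendsto_subseq hv
  have hψtop : Tendsto (fun n => (ψ n : ℝ)) atTop atTop :=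
    tendsto_natCast_atTop_atTop.comp hψ.tendsto_atTop
  have hpos : ∀ q, 0 < a q u → ∀ᶠ n in atTop, clamp (ψ n * a q (v (ψ n))) = 1 := by
    intro q hq
    have := hψtop.atTop_mul_pos hq (((ha q).tendsto u).comp hlim)
    filter_upwards [this.eventually_ge_atTop 1] with n hn using hone _ hn
  have hnegq : ∀ q, a q u < 0 → ∀ᶠ n in atTop, clamp (ψ n * a q (v (ψ n))) = -1 := by
    intro q hq
    have := hψtop.atTop_mul_neg hq (((ha q).tendsto u).comp hlim)
    filter_upwards [this.eventually_le_atBot (-1)] with n hn using hmone _ hn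
  refine ⟨u, hu, fun i => ⟨?_, ?_⟩⟩
  · have hev : ∀ᶠ n in atTop, ∀ q ∈ S i, 0 < a q u → clamp (ψ n * a q (v (ψ n))) = 1 := by
      rw [Filter.eventually_all_finset]
      intro q _
      by_cases h : 0 < a q u
      · simpa [h] using hpos q h
      · simp [h]
    obtain ⟨n, hn⟩ := hev.exists
    have h1 : ∑ q ∈ S i, (if 0 < a q u then (1 : ℝ) else -1) ≤ 0 := by
      refine (Finset.sum_le_sum fun q hq => ?_).trans_eq (h0 (ψ n) i)
      split_ifs with h
      · exact (hn q hq h).ge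
      · exact hge1 _
    rw [Finset.sum_ite, Finset.sum_const, Finset.sum_const, nsmul_eq_mul, nsmul_eq_mul] at h1
    have h2 := Finset.card_filter_add_card_filter_not (s := S i) (fun q => 0 < a q u)
    have h3 : (((S i).filter fun q => 0 < a q u).card : ℝ) ≤
        ((S i).filter fun q => ¬ 0 < a q u).card := by linarith
    have h3 := Nat.cast_le.1 h3
    change 2 * ((S i).filter fun q => 0 < a q u).card ≤ _
    omega
  · have hev : ∀ᶠ n in atTop, ∀ q ∈ S i, a q u < 0 → clamp (ψ n * a q (v (ψ n))) = -1 := by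
      rw [Filter.eventually_all_finset]
      intro q _
      by_cases h : a q u < 0
      · simpa [h] using hnegq q h
      · simp [h]
    obtain ⟨n, hn⟩ := hev.exists
    have h1 : 0 ≤ ∑ q ∈ S i, (if a q u < 0 then (-1 : ℝ) else 1) := by
      refine (h0 (ψ n) i).ge.trans (Finset.sum_le_sum fun q hq => ?_)
      split_ifs with h
      · exact (hn q hq h).le
      · exact hle1 _
    rw [Finset.sum_ite, Finset.sum_const, Finset.sum_const, nsmul_eq_mul, nsmul_eq_mul] at h1
    have h2 := Finset.card_filter_add_card_filter_not (s := S i) (fun q => a q u < 0)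
    have h3 : (((S i).filter fun q => a q u < 0).card : ℝ) ≤
        ((S i).filter fun q => ¬ a q u < 0).card := by linarith
    have h3 := Nat.cast_le.1 h3
    change 2 * ((S i).filter fun q => a q u < 0).card ≤ _
    omega

/-- `ham_sandwich` for polynomials whose degree in the variable `i` is at most `c i`. -/
theorem polynomial_ham_sandwich {σ ι : Type*} [Fintype σ] [Fintype ι] (c : σ → ℕ)
    (hc : Fintype.card ι < ∏ i, (c i + 1)) (S : ι → Finset (σ → ℝ)) :
    ∃ g : MvPolynomial σ ℝ, g ≠ 0 ∧ (∀ i, degreeOf i g ≤ c i) ∧ ∀ i,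
      2 * ((S i).filter fun q => 0 < eval q g).card ≤ (S i).card ∧
      2 * ((S i).filter fun q => eval q g < 0).card ≤ (S i).card := by
  classical
  obtain ⟨b⟩ : Nonempty (Option ι ↪ ∀ i, Fin (c i + 1)) :=
    Function.Embedding.nonempty_of_card_le (by simpa using hc)
  let e : Option ι → σ →₀ ℕ := fun o => Finsupp.equivFunOnFinite.symm fun i => (b o i : ℕ)
  have he : Function.Injective e := fun o o' h =>
    b.injective (funext fun i => Fin.ext (DFunLike.congr_fun h i))
  obtain ⟨v, hv, h⟩ := ham_sandwich (fun o q => eval q (monomial (e o) (1 : ℝ))) S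
  have heval : ∀ q, eval q (∑ o, monomial (e o) (v o)) =
      ∑ o, v o * eval q (monomial (e o) (1 : ℝ)) := by
    intro q
    rw [map_sum]
    refine Finset.sum_congr rfl fun o _ => ?_
    rw [eval_monomial, eval_monomial, one_mul]
  refine ⟨∑ o, monomial (e o) (v o), fun h0 => ?_, fun i => ?_, fun i => ?_⟩
  · have hz : ∀ o, v o = 0 := by
      intro o
      have := congrArg (coeff (e o)) h0
      rw [coeff_sum, Finset.sum_eq_single o] at this
      · simpa using this
      · intro o' _ ho'
        rw [coeff_monomial, if_neg fun hh => ho' (he hh)]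
      · simp
    simp [hz] at hv
  · refine (degreeOf_sum_le i _ _).trans (Finset.sup_le fun o _ => ?_)
    by_cases hvo : v o = 0
    · simp [hvo]
    · rw [degreeOf_monomial_eq _ _ hvo]
      exact Nat.lt_succ_iff.1 (b o i).2
  · simpa only [heval] using h i

/-- Repeated bisection of a finite set: `J` polynomials whose sign patterns cut `Q` into pieces of
at most `#Q / 2 ^ J` points. -/
theorem exists_bisecting_family {σ : Type*} [Fintype σ] (Q : Finset (σ → ℝ)) (c : ℕ → σ → ℕ)
    (J : ℕ) (hc : ∀ j < J, 2 ^ j < ∏ i, (c j i + 1)) :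
    ∃ g : Fin J → MvPolynomial σ ℝ, (∀ j, g j ≠ 0) ∧ (∀ j i, degreeOf i (g j) ≤ c j i) ∧
      ∀ s : Fin J → Bool, 2 ^ J * (Q.filter fun q =>
        ∀ j, if s j then 0 < eval q (g j) else eval q (g j) < 0).card ≤ Q.card := by
  classical
  induction J with
  | zero => exact ⟨fun j => j.elim0, fun j => j.elim0, fun j => j.elim0, fun s => by simp⟩
  | succ J ih =>
    obtain ⟨g, hg0, hgc, hg⟩ := ih fun j hj => hc j (hj.trans (Nat.lt_succ_self J))
    obtain ⟨h, hh0, hhc, hh⟩ := polynomial_ham_sandwich (ι := Fin J → Bool) (c J)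
      (by simpa using hc J (Nat.lt_succ_self J)) fun s => Q.filter fun q =>
        ∀ j, if s j then 0 < eval q (g j) else eval q (g j) < 0
    refine ⟨Fin.snoc g h, ?_, ?_, fun s => ?_⟩
    · intro j
      refine Fin.lastCases ?_ (fun j => ?_) j
      · simpa using hh0
      · simpa using hg0 j
    · intro j
      refine Fin.lastCases ?_ (fun j => ?_) j
      · simpa using hhc
      · simpa using hgc j
    · have h1 := hg fun j => s j.castSucc
      have h2 := hh fun j => s j.castSucc
      simp only [Fin.forall_fin_succ', Fin.snoc_castSucc, Fin.snoc_last]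
      rw [← Finset.filter_filter, pow_succ, mul_assoc]
      refine le_trans (Nat.mul_le_mul_left _ ?_) h1
      cases hs : s (Fin.last J)
      · simpa using h2.2
      · simpa using h2.1

end HamSandwich

section Partition

theorem eval_pos_of_mem_component {g h : MvPolynomial (Fin 3) ℝ} (hg : h ∣ g) {x y z : Fin 3 → ℝ}
    (hx : x ∈ connectedComponentIn (zeroSet g)ᶜ z) (hy : y ∈ connectedComponentIn (zeroSet g)ᶜ z)
    (hpos : 0 < eval x h) : 0 < eval y h := by
  by_contra! hle
  obtain ⟨p, hp, hp0⟩ := isPreconnected_connectedComponentIn.intermediate_value hy hx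
    h.continuous_eval.continuousOn ⟨hle, hpos.le⟩
  refine connectedComponentIn_subset _ _ hp ?_
  obtain ⟨r, rfl⟩ := hg
  have hp0 : eval p h = 0 := hp0
  simp [zeroSet, hp0]

theorem finite_components (g : MvPolynomial (Fin 3) ℝ) :
    {C | IsComponentOf C (zeroSet g)ᶜ}.Finite := by
  by_contra hinf
  obtain ⟨s, hs, hcard⟩ := Set.Infinite.exists_subset_card_eq hinf
    (∏ i, (6 * degreeOf i g + 1) + 1)
  have := card_components_le (fun i => le_refl (degreeOf i g)) s fun C hC => hs hC
  omega

theorem ncard_components_le {g : MvPolynomial (Fin 3) ℝ} {c : Fin 3 → ℕ}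
    (hc : ∀ i, degreeOf i g ≤ c i) :
    {C | IsComponentOf C (zeroSet g)ᶜ}.ncard ≤ ∏ i, (6 * c i + 1) := by
  rw [Set.ncard_eq_toFinset_card _ (finite_components g)]
  exact card_components_le hc _ fun C hC => by simpa using hC

/-- A finite set is partitioned by all components of the complement of `zeroSet g`. -/
theorem exists_partitionedBy (g : MvPolynomial (Fin 3) ℝ) (Q : Finset (Fin 3 → ℝ)) :
    ∃ (t : ℕ) (Q₀ : Finset (Fin 3 → ℝ)) (P : Fin t → Finset (Fin 3 → ℝ)),
      t = {C | IsComponentOf C (zeroSet g)ᶜ}.ncard ∧ PartitionedBy g Q Q₀ P ∧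
        ∀ i, ∃ z ∈ (zeroSet g)ᶜ, ∀ q ∈ P i, q ∈ Q ∧ q ∈ connectedComponentIn (zeroSet g)ᶜ z := by
  classical
  have := (finite_components g).to_subtype
  let e := (Finite.equivFin {C | IsComponentOf C (zeroSet g)ᶜ}).symm
  have hcomp : ∀ i, IsComponentOf (e i).1 (zeroSet g)ᶜ := fun i => (e i).2
  refine ⟨_, Q.filter (· ∈ zeroSet g), fun i => Q.filter (· ∈ (e i).1), rfl, ⟨?_, ?_, ?_, ?_, ?_⟩, ?_⟩
  · ext q
    simp only [Finset.coe_filter, Set.mem_union, Set.mem_iUnion, Set.mem_ofPred_eq,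
      Finset.mem_coe]
    constructor
    · intro hq
      by_cases h : q ∈ zeroSet g
      · exact Or.inl ⟨hq, h⟩
      · refine Or.inr ⟨e.symm ⟨connectedComponentIn (zeroSet g)ᶜ q, q, h, rfl⟩, hq, ?_⟩
        rw [Equiv.apply_symm_apply]
        exact mem_connectedComponentIn h
    · rintro (h | ⟨i, h⟩)
      · exact h.1
      · exact h.1
  · intro i
    rw [Finset.disjoint_left]
    intro q h1 h2
    obtain ⟨x, -, hx⟩ := hcomp i
    have h3 := (Finset.mem_filter.1 h2).2
    rw [hx] at h3
    exact connectedComponentIn_subset _ _ h3 (Finset.mem_filter.1 h1).2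
  · intro i j hij
    rw [Finset.disjoint_left]
    intro q h1 h2
    obtain ⟨x, -, hx⟩ := hcomp i
    obtain ⟨y, -, hy⟩ := hcomp j
    have h3 := (Finset.mem_filter.1 h1).2
    have h4 := (Finset.mem_filter.1 h2).2
    rw [hx] at h3
    rw [hy] at h4
    refine hij (e.injective (Subtype.ext ?_))
    rw [hx, hy, connectedComponentIn_eq h3, connectedComponentIn_eq h4]
  · intro q hq
    exact (Finset.mem_filter.1 hq).2
  · refine ⟨fun i => (e i).1, Subtype.val_injective.comp e.injective, fun i => ⟨hcomp i, ?_⟩⟩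
    intro q hq
    exact (Finset.mem_filter.1 hq).2
  · intro i
    obtain ⟨x, hxg, hx⟩ := hcomp i
    refine ⟨x, hxg, fun q hq => ?_⟩
    rw [Finset.mem_filter, hx] at hq
    exact hq

/-- The product of the linear forms `X i - m` for `m < k i`. -/
noncomputable def gridPolynomial (k : Fin 3 → ℕ) : MvPolynomial (Fin 3) ℝ :=
  ∏ i, ∏ m ∈ Finset.range (k i), (X i - C (m : ℝ))

theorem X_sub_C_ne_zero {σ : Type*} (i : σ) (a : ℝ) : (X i - C a : MvPolynomial σ ℝ) ≠ 0 := by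
  intro h
  have := congrArg (eval fun _ => a + 1) h
  simp at this

theorem gridPolynomial_ne_zero (k : Fin 3 → ℕ) : gridPolynomial k ≠ 0 :=
  Finset.prod_ne_zero_iff.2 fun i _ => Finset.prod_ne_zero_iff.2 fun _ _ => X_sub_C_ne_zero i _

theorem degreeOf_gridPolynomial_le (k : Fin 3 → ℕ) (i : Fin 3) :
    degreeOf i (gridPolynomial k) ≤ k i := by
  have hlin : ∀ j (m : ℕ), degreeOf i (X j - C (m : ℝ) : MvPolynomial (Fin 3) ℝ) ≤
      if i = j then 1 else 0 := by
    intro j m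
    rw [sub_eq_add_neg, ← C_neg]
    refine (degreeOf_add_le _ _ _).trans ?_
    rw [degreeOf_C, degreeOf_X]
    simp
  calc degreeOf i (gridPolynomial k)
      ≤ ∑ j, ∑ m ∈ Finset.range (k j), degreeOf i (X j - C (m : ℝ) : MvPolynomial (Fin 3) ℝ) :=
        (degreeOf_prod_le _ _ _).trans (Finset.sum_le_sum fun j _ => degreeOf_prod_le _ _ _)
    _ ≤ ∑ j, ∑ m ∈ Finset.range (k j), (if i = j then 1 else 0) :=
        Finset.sum_le_sum fun j _ => Finset.sum_le_sum fun m _ => hlin j m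
    _ = k i := by simp

theorem le_ncard_components_of_gridPolynomial_dvd {g : MvPolynomial (Fin 3) ℝ} (hg : g ≠ 0)
    {k : Fin 3 → ℕ} (hk : gridPolynomial k ∣ g) :
    ∏ i, (k i + 1) ≤ {C | IsComponentOf C (zeroSet g)ᶜ}.ncard := by
  have := (finite_components g).to_subtype
  have hpt : ∀ a : ∀ i, Fin (k i + 1), ∃ x : Fin 3 → ℝ, x ∈ (zeroSet g)ᶜ ∧
      ∀ i, (a i : ℝ) - 1 < x i ∧ x i < a i := by
    intro a
    by_contra! h
    refine hg (funext_set (fun i => Set.Ioo ((a i : ℝ) - 1) (a i))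
      (fun i => Set.Ioo_infinite (by linarith)) fun x hx => ?_)
    rw [map_zero]
    by_contra hne
    obtain ⟨i, hi⟩ := h x hne
    exact absurd (hx i trivial).2 (not_lt.2 (hi (hx i trivial).1))
  choose x hx hxa using hpt
  let F : (∀ i, Fin (k i + 1)) → {C | IsComponentOf C (zeroSet g)ᶜ} :=
    fun a => ⟨connectedComponentIn (zeroSet g)ᶜ (x a), x a, hx a, rfl⟩
  have hlt : ∀ a b, F a = F b → ∀ i, ¬ a i < b i := by
    intro a b hab i hi
    have hC : connectedComponentIn (zeroSet g)ᶜ (x a) = connectedComponentIn (zeroSet g)ᶜ (x b) :=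
      congrArg Subtype.val hab
    have hdvd : (X i - C ((a i : ℕ) : ℝ)) ∣ g := by
      refine dvd_trans (dvd_trans ?_ (Finset.dvd_prod_of_mem _ (Finset.mem_univ i))) hk
      refine Finset.dvd_prod_of_mem (fun m : ℕ => (X i - C (m : ℝ) : MvPolynomial (Fin 3) ℝ)) ?_
      have h1 : (a i : ℕ) < b i := hi
      have h2 := (b i).2
      rw [Finset.mem_range]
      omega
    have hb : 0 < eval (x b) (X i - C ((a i : ℕ) : ℝ)) := by
      have h1 : ((a i : ℕ) : ℝ) + 1 ≤ (b i : ℕ) := by exact_mod_cast (show (a i : ℕ) < b i from hi)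
      have h2 := (hxa b i).1
      simp only [map_sub, eval_X, eval_C]
      linarith
    have ha := eval_pos_of_mem_component hdvd (mem_connectedComponentIn (hx b))
      (hC ▸ mem_connectedComponentIn (hx a)) hb
    have h2 := (hxa a i).2
    simp only [map_sub, eval_X, eval_C] at ha
    linarith
  have hF : Function.Injective F := fun a b hab => funext fun i =>
    le_antisymm (not_lt.1 (hlt b a hab.symm i)) (not_lt.1 (hlt a b hab i))
  have := Nat.card_le_card_of_injective F hF
  simpa [Nat.card_coe_set_eq] using this

theorem sum_half_pow_div_three_le (N : ℕ) :
    ∑ i ∈ Finset.range N, (1 / 2 : ℝ) ^ (i / 3) ≤ 6 := by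
  have h : ∀ M : ℕ, ∑ i ∈ Finset.range (3 * M), (1 / 2 : ℝ) ^ (i / 3) = 6 - 6 * (1 / 2) ^ M := by
    intro M
    induction M with
    | zero => simp
    | succ M ih =>
      rw [show 3 * (M + 1) = 3 * M + 1 + 1 + 1 by ring, Finset.sum_range_succ,
        Finset.sum_range_succ, Finset.sum_range_succ, ih, show 3 * M / 3 = M by omega,
        show (3 * M + 1) / 3 = M by omega, show (3 * M + 1 + 1) / 3 = M by omega, pow_succ]
      ring
  calc ∑ i ∈ Finset.range N, (1 / 2 : ℝ) ^ (i / 3)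
      ≤ ∑ i ∈ Finset.range (3 * N), (1 / 2 : ℝ) ^ (i / 3) :=
        Finset.sum_le_sum_of_subset_of_nonneg (Finset.range_mono (by omega))
          fun _ _ _ => by positivity
    _ ≤ 6 := by rw [h]; linarith [show (0 : ℝ) ≤ 6 * (1 / 2) ^ N by positivity]

theorem two_pow_sub_pred_le (n m : ℕ) : ((2 ^ (n - m) - 1 : ℕ) : ℝ) ≤ 2 ^ n * (1 / 2) ^ m := by
  rcases le_total m n with h | h
  · obtain ⟨r, rfl⟩ := Nat.exists_eq_add_of_le h
    rw [Nat.add_sub_cancel_left, pow_add, one_div, inv_pow, mul_comm ((2 : ℝ) ^ m), mul_assoc,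
      mul_inv_cancel₀ (by positivity), mul_one]
    calc ((2 ^ r - 1 : ℕ) : ℝ) ≤ ((2 ^ r : ℕ) : ℝ) := Nat.cast_le.2 (Nat.sub_le _ _)
      _ = 2 ^ r := by push_cast; rfl
  · rw [Nat.sub_eq_zero_of_le h]
    simp only [pow_zero, Nat.sub_self, Nat.cast_zero]
    positivity

/-- The degree in a variable of size exponent `n` allotted to level `j` of `J` bisections. -/
def levelDegree (J n j : ℕ) : ℕ := 2 ^ (n - (6 + (J - 1 - j) / 3)) - 1

theorem sum_levelDegree_le (J n : ℕ) :
    ∑ j : Fin J, (levelDegree J n j : ℝ) ≤ 6 / 64 * 2 ^ n := by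
  calc ∑ j : Fin J, (levelDegree J n j : ℝ)
      ≤ ∑ j : Fin J, 2 ^ n * ((1 / 2) ^ 6 * (1 / 2 : ℝ) ^ ((J - 1 - j) / 3)) :=
        Finset.sum_le_sum fun j _ => by
          rw [← pow_add]
          exact two_pow_sub_pred_le _ _
    _ = 2 ^ n * ((1 / 2) ^ 6 * ∑ i ∈ Finset.range J, (1 / 2 : ℝ) ^ (i / 3)) := by
        rw [Fin.sum_univ_eq_sum_range
          (fun j => (2 : ℝ) ^ n * ((1 / 2) ^ 6 * (1 / 2 : ℝ) ^ ((J - 1 - j) / 3))) J,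
          ← Finset.mul_sum, ← Finset.mul_sum,
          Finset.sum_range_reflect (fun i => (1 / 2 : ℝ) ^ (i / 3)) J]
    _ ≤ 2 ^ n * ((1 / 2) ^ 6 * 6) := by
        gcongr
        exact sum_half_pow_div_three_le J
    _ = 6 / 64 * 2 ^ n := by ring

theorem two_pow_lt_prod_levelDegree {e : Fin 3 → ℕ} {j : ℕ} (hj : j < ∑ i, e i - 18) :
    2 ^ j < ∏ i, (levelDegree (∑ i, e i - 18) (e i) j + 1) := by
  have h : ∀ n, levelDegree (∑ i, e i - 18) n j + 1 =
      2 ^ (n - (6 + (∑ i, e i - 18 - 1 - j) / 3)) := fun n =>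
    Nat.sub_add_cancel Nat.one_le_two_pow
  simp only [h]
  rw [Finset.prod_pow_eq_pow_sum]
  refine Nat.pow_lt_pow_right one_lt_two ?_
  simp only [Fin.sum_univ_three] at hj ⊢
  omega

theorem totalDegree_le_sum_degreeOf {σ : Type*} [Fintype σ] (g : MvPolynomial σ ℝ) :
    g.totalDegree ≤ ∑ i, degreeOf i g := by
  rw [totalDegree]
  refine Finset.sup_le fun e he => ?_
  rw [Finsupp.sum_fintype _ _ (fun _ => rfl)]
  exact Finset.sum_le_sum fun i _ => monomial_le_degreeOf i he

/-- Polynomial partitioning with prescribed sizes `B i` of the degrees in the variables. -/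
theorem exists_partitioning_polynomial (B : Fin 3 → ℝ) (hB : ∀ i, 1 ≤ B i)
    (Q : Finset (Fin 3 → ℝ)) :
    ∃ (g : MvPolynomial (Fin 3) ℝ) (t : ℕ) (Q₀ : Finset (Fin 3 → ℝ))
      (P : Fin t → Finset (Fin 3 → ℝ)), g ≠ 0 ∧ (∀ i, (degreeOf i g : ℝ) ≤ B i / 4) ∧
        (∏ i, B i) / 512 ≤ t ∧ (t : ℝ) ≤ 27 * ∏ i, B i ∧ PartitionedBy g Q Q₀ P ∧
        ∀ i, ((P i).card : ℝ) ≤ 27 * 2 ^ 21 * (Q.card / t) := by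
  classical
  let e : Fin 3 → ℕ := fun i => Nat.log 2 ⌊B i⌋₊
  let k : Fin 3 → ℕ := fun i => ⌊B i / 8⌋₊
  let J := ∑ i, e i - 18
  have hBpos : ∀ i, 0 < B i := fun i => one_pos.trans_le (hB i)
  have he1 : ∀ i, (2 : ℝ) ^ e i ≤ B i := by
    intro i
    have h1 : 2 ^ e i ≤ ⌊B i⌋₊ :=
      Nat.pow_log_le_self 2 (Nat.floor_pos.2 (hB i)).ne'
    calc (2 : ℝ) ^ e i = ((2 ^ e i : ℕ) : ℝ) := by push_cast; rfl
      _ ≤ (⌊B i⌋₊ : ℝ) := Nat.cast_le.2 h1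
      _ ≤ B i := Nat.floor_le (hBpos i).le
  have he2 : ∀ i, B i ≤ 2 * 2 ^ e i := by
    intro i
    have h1 : ⌊B i⌋₊ < 2 ^ (e i + 1) := Nat.lt_pow_succ_log_self one_lt_two _
    have h2 : ((⌊B i⌋₊ + 1 : ℕ) : ℝ) ≤ ((2 ^ (e i + 1) : ℕ) : ℝ) := Nat.cast_le.2 h1
    have h3 := Nat.lt_floor_add_one (B i)
    push_cast at h2
    rw [pow_succ] at h2
    linarith
  obtain ⟨g, hg0, hgdeg, hg⟩ := exists_bisecting_family Q (fun j i => levelDegree J (e i) j) J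
    fun j hj => two_pow_lt_prod_levelDegree hj
  let G := (∏ j, g j) * gridPolynomial k
  have hG : G ≠ 0 := mul_ne_zero (Finset.prod_ne_zero_iff.2 fun j _ => hg0 j)
    (gridPolynomial_ne_zero k)
  let b : Fin 3 → ℕ := fun i => ∑ j : Fin J, levelDegree J (e i) j + k i
  have hGb : ∀ i, degreeOf i G ≤ b i := fun i =>
    (degreeOf_mul_le _ _ _).trans (add_le_add
      ((degreeOf_prod_le _ _ _).trans (Finset.sum_le_sum fun j _ => hgdeg j i))
      (degreeOf_gridPolynomial_le k i))
  have hb : ∀ i, (b i : ℝ) ≤ B i / 4 := by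
    intro i
    have h1 := sum_levelDegree_le J (e i)
    have h2 : (k i : ℝ) ≤ B i / 8 := Nat.floor_le (by linarith [hBpos i])
    have h3 := he1 i
    have h4 := hBpos i
    simp only [b]
    push_cast
    linarith
  obtain ⟨t, Q₀, P, ht, hP, hPcell⟩ := exists_partitionedBy G Q
  have htlow : (∏ i, B i) / 512 ≤ t := by
    have h1 : ∏ i, (B i / 8) ≤ ((∏ i, (k i + 1) : ℕ) : ℝ) := by
      push_cast
      exact Finset.prod_le_prod (fun i _ => by linarith [hBpos i])
        fun i _ => (Nat.lt_floor_add_one _).le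
    have h2 : ((∏ i, (k i + 1) : ℕ) : ℝ) ≤ t :=
      Nat.cast_le.2 (ht ▸ le_ncard_components_of_gridPolynomial_dvd hG (dvd_mul_left _ _))
    refine le_trans (le_of_eq ?_) (h1.trans h2)
    rw [Fin.prod_univ_three, Fin.prod_univ_three]
    ring
  have htup : (t : ℝ) ≤ 27 * ∏ i, B i := by
    have h1 : (t : ℝ) ≤ ((∏ i, (6 * b i + 1) : ℕ) : ℝ) :=
      Nat.cast_le.2 (ht ▸ ncard_components_le hGb)
    have h2 : ((∏ i, (6 * b i + 1) : ℕ) : ℝ) ≤ ∏ i, (3 * B i) := by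
      push_cast
      exact Finset.prod_le_prod (fun i _ => by positivity) fun i _ => by linarith [hb i, hB i]
    refine (h1.trans h2).trans (le_of_eq ?_)
    rw [Fin.prod_univ_three, Fin.prod_univ_three]
    ring
  have hprod : 0 < ∏ i, B i := Finset.prod_pos fun i _ => hBpos i
  have htpos : (0 : ℝ) < t := by linarith
  have hJ : ∏ i, B i ≤ 2 ^ 21 * 2 ^ J := by
    calc ∏ i, B i ≤ ∏ i, (2 * 2 ^ e i : ℝ) :=
          Finset.prod_le_prod (fun i _ => (hBpos i).le) fun i _ => he2 i
      _ = 2 ^ (3 + ∑ i, e i) := by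
          rw [Fin.prod_univ_three, Fin.sum_univ_three]
          ring
      _ ≤ 2 ^ (21 + J) := pow_le_pow_right₀ one_le_two (by omega)
      _ = 2 ^ 21 * 2 ^ J := pow_add _ _ _
  refine ⟨G, t, Q₀, P, hG, fun i => (Nat.cast_le.2 (hGb i)).trans (hb i), htlow, htup, hP,
    fun i => ?_⟩
  obtain ⟨z, hz, hPz⟩ := hPcell i
  have hdvd : ∀ j, g j ∣ G := fun j =>
    dvd_mul_of_dvd_left (Finset.dvd_prod_of_mem g (Finset.mem_univ j)) _
  have hsub : P i ⊆ Q.filter fun q =>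
      ∀ j, if decide (0 < eval z (g j)) then 0 < eval q (g j) else eval q (g j) < 0 := by
    intro q hq
    obtain ⟨hqQ, hqz⟩ := hPz q hq
    refine Finset.mem_filter.2 ⟨hqQ, fun j => ?_⟩
    have hzz := mem_connectedComponentIn hz
    by_cases h : 0 < eval z (g j)
    · simpa [h] using eval_pos_of_mem_component (hdvd j) hzz hqz h
    · have hq0 : eval q (g j) ≠ 0 := by
        intro h0
        obtain ⟨r, hr⟩ := hdvd j
        refine connectedComponentIn_subset _ _ hqz ?_
        change eval q G = 0
        rw [hr, map_mul, h0, zero_mul]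
      have : ¬ 0 < eval q (g j) := fun h' => h (eval_pos_of_mem_component (hdvd j) hqz hzz h')
      simpa [h] using lt_of_le_of_ne (not_lt.1 this) hq0
  have hcard : (2 : ℝ) ^ J * (P i).card ≤ Q.card := by
    have := (Nat.mul_le_mul_left (2 ^ J) (Finset.card_le_card hsub)).trans
      (hg fun j => decide (0 < eval z (g j)))
    exact_mod_cast this
  rw [← mul_div_assoc, le_div_iff₀ htpos]
  have hP0 : (0 : ℝ) ≤ (P i).card := Nat.cast_nonneg _
  calc ((P i).card : ℝ) * t ≤ (P i).card * (27 * (2 ^ 21 * 2 ^ J)) := by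
        refine mul_le_mul_of_nonneg_left (htup.trans ?_) hP0
        exact mul_le_mul_of_nonneg_left hJ (by norm_num)
    _ = 27 * 2 ^ 21 * (2 ^ J * (P i).card) := by ring
    _ ≤ 27 * 2 ^ 21 * Q.card := by gcongr

end Partition

section LinearChange

theorem partitionedBy_map {g g' : MvPolynomial (Fin 3) ℝ} (h : (Fin 3 → ℝ) ≃ₜ (Fin 3 → ℝ))
    (hz : ∀ x, h x ∈ zeroSet g ↔ x ∈ zeroSet g') {Q Q₀ : Finset (Fin 3 → ℝ)} {t : ℕ}
    {P : Fin t → Finset (Fin 3 → ℝ)} (hP : PartitionedBy g' Q Q₀ P) :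
    PartitionedBy g (Q.map h.toEmbedding) (Q₀.map h.toEmbedding)
      fun i => (P i).map h.toEmbedding := by
  have hS : (zeroSet g)ᶜ = h '' (zeroSet g')ᶜ := by
    ext x
    rw [h.image_eq_preimage_symm, Set.mem_preimage, Set.mem_compl_iff, Set.mem_compl_iff, ← hz,
      h.apply_symm_apply]
  refine ⟨?_, fun i => ?_, fun i j hij => ?_, ?_, ?_⟩
  · simp only [Finset.coe_map, hP.cover, Set.image_union, Set.image_iUnion]
  · rw [Finset.disjoint_map]
    exact hP.disjoint_zero i
  · rw [Finset.disjoint_map]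
    exact hP.disjoint_parts i j hij
  · rw [Finset.coe_map]
    rintro _ ⟨x, hx, rfl⟩
    exact (hz x).2 (hP.zero_subset hx)
  · obtain ⟨C, hC, hCP⟩ := hP.distinct_components
    refine ⟨fun i => h '' C i, fun i j hij => hC (h.injective.image_injective hij),
      fun i => ⟨?_, ?_⟩⟩
    · obtain ⟨x, hx, hxC⟩ := (hCP i).1
      refine ⟨h x, hS ▸ Set.mem_image_of_mem h hx, ?_⟩
      beta_reduce
      rw [hxC, hS, h.image_connectedComponentIn hx]
    · rw [Finset.coe_map]
      exact Set.image_mono (hCP i).2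

theorem totalDegree_aeval_le {σ τ : Type*} (A : σ → MvPolynomial τ ℝ)
    (hA : ∀ i, (A i).totalDegree ≤ 1) (p : MvPolynomial σ ℝ) :
    (aeval A p).totalDegree ≤ p.totalDegree := by
  conv_lhs => rw [p.as_sum, map_sum]
  refine totalDegree_finsetSum_le fun e he => ?_
  rw [aeval_monomial, algebraMap_eq]
  refine (totalDegree_mul _ _).trans ?_
  rw [totalDegree_C, zero_add, Finsupp.prod]
  refine (totalDegree_finsetProd _ _).trans (le_trans ?_ (le_totalDegree he))
  refine Finset.sum_le_sum fun i _ => (totalDegree_pow _ _).trans ?_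
  simpa using Nat.mul_le_mul_left (e i) (hA i)

/-- A polynomial of degree `D` has degree `D` along almost every line through the origin. -/
theorem exists_direction {f : MvPolynomial (Fin 3) ℝ} (hf : f ≠ 0) :
    ∃ u : Fin 3 → ℝ, u 2 ≠ 0 ∧ f.totalDegree ≤
      (aeval (fun i => Polynomial.C (u i) * Polynomial.X) f : Polynomial ℝ).natDegree := by
  have hne : homogeneousComponent f.totalDegree f ≠ 0 := by
    obtain ⟨e, he, hsup⟩ := Finset.exists_mem_eq_sup f.support (support_nonempty.2 hf)
      fun e => e.sum fun _ n => n
    intro h0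
    have h1 := congrArg (coeff e) h0
    rw [coeff_homogeneousComponent, if_pos, coeff_zero] at h1
    · exact mem_support_iff.1 he h1
    · rw [totalDegree, hsup]
      rfl
  obtain ⟨u, hu⟩ : ∃ u, eval u (homogeneousComponent f.totalDegree f * X 2) ≠ 0 := by
    by_contra! h
    exact mul_ne_zero hne (X_ne_zero 2) (MvPolynomial.funext fun x => by rw [h, map_zero])
  rw [map_mul, eval_X] at hu
  refine ⟨u, right_ne_zero_of_mul hu, Polynomial.le_natDegree_of_ne_zero ?_⟩
  convert left_ne_zero_of_mul hu using 1
  have hmono : ∀ e : Fin 3 →₀ ℕ,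
      (aeval (fun i => Polynomial.C (u i) * Polynomial.X) (monomial e (coeff e f)) : Polynomial ℝ) =
        Polynomial.C (eval u (monomial e (coeff e f))) * Polynomial.X ^ e.degree := by
    intro e
    rw [aeval_monomial, eval_monomial, Finsupp.prod_fintype _ _ (by simp),
      Finsupp.prod_fintype _ _ (by simp), Finsupp.degree_eq_sum]
    simp only [mul_pow, Finset.prod_mul_distrib, Finset.prod_pow_eq_pow_sum, map_mul, map_prod,
      map_pow, Polynomial.algebraMap_eq, mul_assoc]
  conv_lhs => rw [f.as_sum, map_sum]
  simp only [hmono]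
  rw [Polynomial.finsetSum_coeff, homogeneousComponent_apply, map_sum, Finset.sum_filter]
  refine Finset.sum_congr rfl fun e _ => ?_
  rw [Polynomial.coeff_C_mul, Polynomial.coeff_X_pow]
  by_cases h : e.degree = f.totalDegree
  · simp [h]
  · simp [h, Ne.symm h]

theorem natDegree_aeval_axis_le (p : MvPolynomial (Fin 3) ℝ) :
    (aeval ![0, 0, Polynomial.X] p : Polynomial ℝ).natDegree ≤ degreeOf 2 p := by
  conv_lhs => rw [p.as_sum, map_sum]
  refine Polynomial.natDegree_sum_le_of_forall_le _ _ fun e he => ?_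
  refine le_trans ?_ (monomial_le_degreeOf 2 he)
  rw [aeval_monomial, Finsupp.prod_fintype _ _ (by simp), Fin.prod_univ_three,
    Polynomial.algebraMap_eq]
  refine (Polynomial.natDegree_C_mul_le _ _).trans ?_
  simp only [Matrix.cons_val_zero, Matrix.cons_val_one, Matrix.cons_val]
  refine Polynomial.natDegree_mul_le.trans ?_
  have h0 : (0 ^ e 0 * 0 ^ e 1 : Polynomial ℝ).natDegree = 0 := by
    simp only [zero_pow_eq]
    split_ifs <;> simp
  rw [Polynomial.natDegree_X_pow, h0, zero_add]

theorem eval_aeval {σ τ : Type*} (A : σ → MvPolynomial τ ℝ) (x : τ → ℝ) (p : MvPolynomial σ ℝ) :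
    eval x (aeval A p) = eval (fun i => eval x (A i)) p := by
  induction p using MvPolynomial.induction_on with
  | C a => simp
  | add p q hp hq => rw [map_add, map_add, map_add, hp, hq]
  | mul_X p i hp => rw [map_mul, map_mul, map_mul, hp, aeval_X, eval_X]

/-- The linear change of coordinates with columns `e₀`, `e₁`, `u`. -/
noncomputable def shear (u : Fin 3 → ℝ) : Fin 3 → MvPolynomial (Fin 3) ℝ :=
  ![X 0 + C (u 0) * X 2, X 1 + C (u 1) * X 2, C (u 2) * X 2]

/-- The inverse of `shear u`. -/
noncomputable def shearInv (u : Fin 3 → ℝ) : Fin 3 → MvPolynomial (Fin 3) ℝ :=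
  ![X 0 + C (-(u 0 / u 2)) * X 2, X 1 + C (-(u 1 / u 2)) * X 2, C (u 2)⁻¹ * X 2]

theorem totalDegree_shearInv_le (u : Fin 3 → ℝ) (i : Fin 3) : (shearInv u i).totalDegree ≤ 1 := by
  have hC : ∀ (a : ℝ) (j : Fin 3), (C a * X j : MvPolynomial (Fin 3) ℝ).totalDegree ≤ 1 := by
    intro a j
    refine (totalDegree_mul _ _).trans ?_
    rw [totalDegree_C, totalDegree_X]
  have hadd : ∀ (a : ℝ) (j k : Fin 3),
      (X j + C a * X k : MvPolynomial (Fin 3) ℝ).totalDegree ≤ 1 := fun a j k =>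
    (totalDegree_add _ _).trans (max_le (totalDegree_X (R := ℝ) j).le (hC a k))
  fin_cases i
  · exact hadd _ _ _
  · exact hadd _ _ _
  · exact hC _ _

/-- `shear u` as a homeomorphism of `ℝ³`. -/
noncomputable def shearHomeomorph (u : Fin 3 → ℝ) (hu : u 2 ≠ 0) :
    (Fin 3 → ℝ) ≃ₜ (Fin 3 → ℝ) where
  toFun x i := eval x (shear u i)
  invFun x i := eval x (shearInv u i)
  left_inv x := by
    ext i
    fin_cases i <;> simp [shear, shearInv] <;> field_simp <;> ring
  right_inv x := by
    ext i
    fin_cases i <;> simp [shear, shearInv] <;> field_simp <;> ring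
  continuous_toFun := continuous_pi fun i => (shear u i).continuous_eval
  continuous_invFun := continuous_pi fun i => (shearInv u i).continuous_eval

theorem aeval_axis_aeval_shear (u : Fin 3 → ℝ) (f : MvPolynomial (Fin 3) ℝ) :
    (aeval ![0, 0, Polynomial.X] (aeval (shear u) f) : Polynomial ℝ) =
      aeval (fun i => Polynomial.C (u i) * Polynomial.X) f := by
  rw [← AlgHom.comp_apply]
  congr 1
  refine MvPolynomial.algHom_ext fun i => ?_
  fin_cases i <;> simp [shear]

end LinearChange

end PolynomialPartition

open PolynomialPartition MvPolynomial in
theorem lemma4 :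
    ∃ c₁ c₂ c₃ : ℝ, 0 < c₁ ∧ 0 < c₂ ∧ 0 < c₃ ∧
      ∀ (f : MvPolynomial (Fin 3) ℝ) (D : ℕ) (E : ℝ) (Q : Finset (Fin 3 → ℝ)),
        Irreducible f → f.totalDegree = D → (D : ℝ) ≤ E →
        ∃ (g : MvPolynomial (Fin 3) ℝ) (t : ℕ) (Q₀ : Finset (Fin 3 → ℝ))
          (P : Fin t → Finset (Fin 3 → ℝ)),
          (g.totalDegree : ℝ) ≤ E ∧
          IsRelPrime f g ∧
          c₁ * ((D : ℝ) * E ^ 2) ≤ (t : ℝ) ∧ (t : ℝ) ≤ c₂ * ((D : ℝ) * E ^ 2) ∧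
          PartitionedBy g Q Q₀ P ∧
          ∀ i, ((P i).card : ℝ) ≤ c₃ * ((Q.card : ℝ) / (t : ℝ)) := by
  refine ⟨1 / 512, 27, 27 * 2 ^ 21, by norm_num, by norm_num, by norm_num, ?_⟩
  intro f D E Q hf hD hDE
  have hD1 : 1 ≤ D := by
    rw [Nat.one_le_iff_ne_zero]
    rintro rfl
    rw [totalDegree_eq_zero_iff_eq_C] at hD
    have h0 : coeff 0 f ≠ 0 := fun h => hf.ne_zero (by rw [hD, h, C_0])
    exact hf.not_isUnit (hD ▸ (isUnit_iff_ne_zero.2 h0).map C)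
  have hD1' : (1 : ℝ) ≤ D := by exact_mod_cast hD1
  obtain ⟨u, hu, hdeg⟩ := exists_direction hf.ne_zero
  let h := shearHomeomorph u hu
  obtain ⟨g, t, Q₀, P, hg0, hgdeg, ht1, ht2, hP, hPcard⟩ :=
    exists_partitioning_polynomial ![E, E, D]
      (by intro i; fin_cases i <;> simp <;> linarith) (Q.map h.symm.toEmbedding)
  have hprod : ∏ i, (![E, E, (D : ℝ)] : Fin 3 → ℝ) i = D * E ^ 2 := by
    simp [Fin.prod_univ_three]
    ring
  rw [hprod] at ht1 ht2
  have heval : ∀ x, eval (h x) (aeval (shearInv u) g) = eval x g := by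
    intro x
    rw [eval_aeval]
    exact congrArg (fun y => eval y g) (h.left_inv x)
  have hQ : (Q.map h.symm.toEmbedding).map h.toEmbedding = Q := by
    ext x
    simp
  refine ⟨aeval (shearInv u) g, t, Q₀.map h.toEmbedding, fun i => (P i).map h.toEmbedding,
    ?_, ?_, by linarith, ht2, ?_, fun i => ?_⟩
  · have h1 : (aeval (shearInv u) g).totalDegree ≤ ∑ i, degreeOf i g :=
      (totalDegree_aeval_le _ (totalDegree_shearInv_le u) g).trans (totalDegree_le_sum_degreeOf g)
    have h2 : ((aeval (shearInv u) g).totalDegree : ℝ) ≤ ((∑ i, degreeOf i g : ℕ) : ℝ) :=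
      Nat.cast_le.2 h1
    have h3 := hgdeg 0
    have h4 := hgdeg 1
    have h5 := hgdeg 2
    rw [Fin.sum_univ_three] at h2
    push_cast at h2
    simp at h3 h4 h5
    linarith
  · rw [hf.isRelPrime_iff_not_dvd]
    intro hdvd
    have hid : aeval (shear u) (aeval (shearInv u) g) = g := by
      refine MvPolynomial.funext fun x => ?_
      rw [eval_aeval]
      exact heval x
    obtain ⟨r, hr⟩ := map_dvd (aeval (shear u)) hdvd
    rw [hid] at hr
    have hr0 := hr ▸ hg0
    have h1 : D ≤ degreeOf 2 g := by
      rw [hr, degreeOf_mul_eq (left_ne_zero_of_mul hr0) (right_ne_zero_of_mul hr0)]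
      refine le_trans ?_ (Nat.le_add_right _ _)
      refine le_trans ?_ (natDegree_aeval_axis_le _)
      rwa [aeval_axis_aeval_shear, ← hD]
    have h2 : (D : ℝ) ≤ degreeOf 2 g := Nat.cast_le.2 h1
    have h3 := hgdeg 2
    simp at h3
    linarith
  · have := partitionedBy_map h (g := aeval (shearInv u) g) (fun x => ?_) hP
    · rwa [hQ] at this
    · change eval (h x) _ = 0 ↔ eval x g = 0
      rw [heval]
  · rw [Finset.card_map]
    simpa using hPcard i
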